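/- Let $\mathbb K$ be $\mathbb R$ or $\mathbb C$, let $c_0$, $\ell_1$, $\ell_2$ be the usual spaces of $\mathbb K$-valued sequences, and let $B(X,Y)$ be the space of bounded linear operators from $X$ to $Y$. For $T\in B(X,Y)$ and $n\ge 1$ define the approximation, Weyl, Chang and Hilbert numbers $$a_n(T)=\inf\{\|T-S\| : S\in B(X,Y),\ \operatorname{rank} S<n\},$$ $$x_n(T)=\sup\{a_n(Tu) : u\in B(\ell_2,X),\ \|u\|\le 1\},\qquad y_n(T)=\sup\{a_n(vT) : v\in B(Y,\ell_2),\ \|v\|\le 1\},$$ $$h_n(T)=\sup\{a_n(vTu) : u\in B(\ell_2,X),\ v\in B(Y,\ell_2),\ \|u\|\,\|v\|\le 1\}.$$ **Proposition.** For every $T\in B(c_0,\ell_1)$, $$\lim_{k\to\infty}\sqrt k\,x_k(T)=0,\qquad \lim_{k\to\infty}\sqrt k\,y_k(T)=0,\qquad \lim_{k\to\infty} k\,h_k(T)=0 .$$ Consequently, lower bounds of the form $x_m(T)\ge\alpha_m/(9\sqrt m)$, $y_m(T)\ge\alpha_m/(9\sqrt m)$, $h_m(T)\ge\alpha_m/(9m)$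 (for all $m\ge 1$), with $T$ depending on a prescribed sequence $\alpha_1\ge\alpha_2\ge\dots\ge 0$, $\alpha_m\to 0$, cannot be improved in order for the pair $(c_0,\ell_1)$: let $\varphi:\{1,2,\dots\}\to\mathbb R$ and let $s$ be one of $x$, $y$, $h$. If for every sequence $\alpha_1\ge\alpha_2\ge\dots\ge0$ with $\alpha_m\to0$ there is $T\in B(c_0,\ell_1)$ with $s_m(T)\ge\alpha_m\varphi(m)$ for all $m\ge1$, then there is a constant $C$ such that, for all $m\ge1$, $\varphi(m)\le C/\sqrt m$ when $s=x$ or $s=y$, and $\varphi(m)\le C/m$ when $s=h$. -/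

import Mathlib

open Filter Topology
open scoped ZeroAtInfty

noncomputable section

namespace SNumbers

/-- The Banach space `ℓ_1` of absolutely summable scalar sequences indexed by `ℕ`. -/
abbrev Ell1 (𝕜 : Type*) [RCLike 𝕜] : Type _ := lp (fun _ : ℕ => 𝕜) 1

/-- The Hilbert space `ℓ_2` of scalar sequences indexed by `ℕ`. -/
abbrev Ell2 (𝕜 : Type*) [RCLike 𝕜] : Type _ := lp (fun _ : ℕ => 𝕜) 2

/-- The Banach space `c_0` of scalar sequences tending to zero, with the supremum norm
(every function on the discrete space `ℕ` is continuous). -/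
abbrev CZero (𝕜 : Type*) [RCLike 𝕜] : Type _ := C₀(ℕ, 𝕜)

variable {𝕜 : Type*} [RCLike 𝕜]
  {X : Type*} [NormedAddCommGroup X] [NormedSpace 𝕜 X]
  {Y : Type*} [NormedAddCommGroup Y] [NormedSpace 𝕜 Y]

/-- The `n`-th approximation number
`a_n(T) = inf {‖T - S‖ : S ∈ B(X, Y), rank S < n}`, for `n ≥ 1`. -/
def approxNumber (n : ℕ) (T : X →L[𝕜] Y) : ℝ :=
  sInf {r : ℝ | ∃ S : X →L[𝕜] Y,
    LinearMap.rank (S : X →ₗ[𝕜] Y) < (n : Cardinal) ∧ r = ‖T - S‖}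

/-- The `n`-th Weyl number
`x_n(T) = sup {a_n(T u) : u : ℓ_2 → X, ‖u‖ ≤ 1}`, for `n ≥ 1`. -/
def weylNumber (n : ℕ) (T : X →L[𝕜] Y) : ℝ :=
  sSup {r : ℝ | ∃ u : Ell2 𝕜 →L[𝕜] X, ‖u‖ ≤ 1 ∧ r = approxNumber n (T ∘L u)}

/-- The `n`-th Chang number
`y_n(T) = sup {a_n(v T) : v : Y → ℓ_2, ‖v‖ ≤ 1}`, for `n ≥ 1`. -/
def changNumber (n : ℕ) (T : X →L[𝕜] Y) : ℝ :=
  sSup {r : ℝ | ∃ v : Y →L[𝕜] Ell2 𝕜, ‖v‖ ≤ 1 ∧ r = approxNumber n (v ∘L T)}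

/-- The `n`-th Hilbert number
`h_n(T) = sup {a_n(v T u) : u : ℓ_2 → X, v : Y → ℓ_2, ‖u‖ ‖v‖ ≤ 1}`, for `n ≥ 1`. -/
def hilbertNumber (n : ℕ) (T : X →L[𝕜] Y) : ℝ :=
  sSup {r : ℝ | ∃ (u : Ell2 𝕜 →L[𝕜] X) (v : Y →L[𝕜] Ell2 𝕜),
    ‖u‖ * ‖v‖ ≤ 1 ∧ r = approxNumber n (v ∘L T ∘L u)}

/-! The infimum and the suprema above are genuine: the sets are nonempty and bounded. -/

theorem approxNumber_isGLB {n : ℕ} (hn : 1 ≤ n) (T : X →L[𝕜] Y) :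
    IsGLB {r : ℝ | ∃ S : X →L[𝕜] Y,
      LinearMap.rank (S : X →ₗ[𝕜] Y) < (n : Cardinal) ∧ r = ‖T - S‖} (approxNumber n T) := by
  refine isGLB_csInf ⟨‖T - 0‖, 0, ?_, rfl⟩ ⟨0, ?_⟩
  · have h : ((0 : X →L[𝕜] Y) : X →ₗ[𝕜] Y) = 0 := rfl
    rw [h, LinearMap.rank_zero]
    exact_mod_cast hn
  · rintro r ⟨S, -, rfl⟩
    exact norm_nonneg _

theorem approxNumber_le_norm (n : ℕ) (T : X →L[𝕜] Y) : approxNumber n T ≤ ‖T‖ := by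
  rcases Nat.eq_zero_or_pos n with rfl | hn
  · have h : approxNumber 0 T = 0 := by
      unfold approxNumber
      convert Real.sInf_empty using 2
      ext r
      simp
    rw [h]
    exact norm_nonneg T
  · refine (approxNumber_isGLB hn T).1 ⟨0, ?_, by simp⟩
    have h : ((0 : X →L[𝕜] Y) : X →ₗ[𝕜] Y) = 0 := rfl
    rw [h, LinearMap.rank_zero]
    exact_mod_cast hn

theorem weylNumber_isLUB (n : ℕ) (T : X →L[𝕜] Y) :
    IsLUB {r : ℝ | ∃ u : Ell2 𝕜 →L[𝕜] X, ‖u‖ ≤ 1 ∧ r = approxNumber n (T ∘L u)}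
      (weylNumber n T) := by
  refine isLUB_csSup ⟨_, 0, by simp, rfl⟩ ⟨‖T‖, ?_⟩
  rintro r ⟨u, hu, rfl⟩
  calc approxNumber n (T ∘L u) ≤ ‖T ∘L u‖ := approxNumber_le_norm _ _
    _ ≤ ‖T‖ * ‖u‖ := ContinuousLinearMap.opNorm_comp_le _ _
    _ ≤ ‖T‖ := mul_le_of_le_one_right (norm_nonneg _) hu

theorem changNumber_isLUB (n : ℕ) (T : X →L[𝕜] Y) :
    IsLUB {r : ℝ | ∃ v : Y →L[𝕜] Ell2 𝕜, ‖v‖ ≤ 1 ∧ r = approxNumber n (v ∘L T)}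
      (changNumber n T) := by
  refine isLUB_csSup ⟨_, 0, by simp, rfl⟩ ⟨‖T‖, ?_⟩
  rintro r ⟨v, hv, rfl⟩
  calc approxNumber n (v ∘L T) ≤ ‖v ∘L T‖ := approxNumber_le_norm _ _
    _ ≤ ‖v‖ * ‖T‖ := ContinuousLinearMap.opNorm_comp_le _ _
    _ ≤ ‖T‖ := mul_le_of_le_one_left (norm_nonneg _) hv

theorem hilbertNumber_isLUB (n : ℕ) (T : X →L[𝕜] Y) :
    IsLUB {r : ℝ | ∃ (u : Ell2 𝕜 →L[𝕜] X) (v : Y →L[𝕜] Ell2 𝕜),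
      ‖u‖ * ‖v‖ ≤ 1 ∧ r = approxNumber n (v ∘L T ∘L u)} (hilbertNumber n T) := by
  refine isLUB_csSup ⟨_, 0, 0, by simp, rfl⟩ ⟨‖T‖, ?_⟩
  rintro r ⟨u, v, huv, rfl⟩
  calc approxNumber n (v ∘L T ∘L u) ≤ ‖v ∘L T ∘L u‖ := approxNumber_le_norm _ _
    _ ≤ ‖v‖ * ‖T ∘L u‖ := ContinuousLinearMap.opNorm_comp_le _ _
    _ ≤ ‖v‖ * (‖T‖ * ‖u‖) := by gcongr; exact ContinuousLinearMap.opNorm_comp_le _ _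
    _ = ‖T‖ * (‖u‖ * ‖v‖) := by ring
    _ ≤ ‖T‖ := mul_le_of_le_one_right (norm_nonneg _) huv

/-- `φ` is an admissible lower rate for the numbers `s` on operators from `X` to `Y`: for every
sequence `α_1 ≥ α_2 ≥ … ≥ 0` with limit `0` there is `T ∈ B(X, Y)` with `s_m(T) ≥ α_m φ(m)`
for all `m ≥ 1`. -/
def AdmissibleLowerRate (s : ℕ → (X →L[𝕜] Y) → ℝ) (φ : ℕ → ℝ) : Prop :=
  ∀ α : ℕ → ℝ, Antitone α → Tendsto α atTop (𝓝 0) →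
    ∃ T : X →L[𝕜] Y, ∀ m : ℕ, 1 ≤ m → α m * φ m ≤ s m T

end SNumbers

end

/-! The heart is Grothendieck's theorem: every bounded `T : c_0 → ℓ_1` factors as `D_b B D_a`, with
`B` bounded on `ℓ_2` and diagonal operators given by `a, b ∈ ℓ_2` (`exists_factorization`). For `u :
ℓ_2 → c_0`, Bessel's inequality in each coordinate shows that `D_a u` has Hilbert–Schmidt norm at
most `‖a‖ ‖u‖`, hence lies within `‖a‖ ‖u‖ / √(k+1)` of an operator of rank at most `k`; dually for
`v D_b`. This gives `O(k^{-1/2})` at either end. Splitting off the first `n` coordinates of `a`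
costs rank `n` and replaces `‖a‖` by the norm of a tail, as small as desired: this turns `O` into
`o`. Weyl numbers use the `a` end, Chang numbers the `b` end, Hilbert numbers both, whence the rate
`1/k`.

The factorization comes from Grothendieck's inequality for finite matrices (random signs, truncation
and a self-improving constant), which Hahn–Banach separation turns into domination by probability
weights. Compactness carries the weights to infinite sequences, and their square roots, slightly
enlarged, become `a` and `b`.

For the optimality claim, an unbounded `g φ` is tested against `α = 1/G`, where `G` is the running
maximum of `g φ` and `1` (`AdmissibleLowerRate.exists_le_div`). -/

namespace SNumbers

/-! ### Moments of random sign sums -/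

/-- Finite families of independent signs, through the moments of their linear combinations. -/
theorem exists_rademacher (𝕜 : Type*) [RCLike 𝕜] (N : ℕ) :
    ∃ (Ω : Type) (_ : Fintype Ω) (_ : Nonempty Ω) (r : Fin N → Ω → 𝕜),
      (∀ a b : Fin N → 𝕜, ∑ ω, (∑ k, r k ω * a k) * (∑ k, r k ω * b k)
        = Fintype.card Ω * ∑ k, a k * b k) ∧
      (∀ a : Fin N → 𝕜, ∑ ω, ‖∑ k, r k ω * a k‖ ^ 2 = Fintype.card Ω * ∑ k, ‖a k‖ ^ 2) ∧
      (∀ a : Fin N → 𝕜, ∑ ω, ‖∑ k, r k ω * a k‖ ^ 4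
        ≤ 3 * Fintype.card Ω * (∑ k, ‖a k‖ ^ 2) ^ 2) := by
  induction N with
  | zero => exact ⟨Unit, inferInstance, inferInstance, fun _ _ => 0, by simp, by simp, by simp⟩
  | succ N ih =>
    obtain ⟨Ω, _, _, r, h1, h2, h4⟩ := ih
    refine ⟨Ω × Bool, inferInstance, inferInstance,
      fun k ω => Fin.cases (if ω.2 then 1 else -1) (fun k => r k ω.1) k, ?_, ?_, ?_⟩
    · intro a b
      have := h1 (fun k => a k.succ) (fun k => b k.succ)
      simp only [Fintype.sum_prod_type, Fintype.sum_bool, Fin.sum_univ_succ, Fin.cases_zero,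
        Fin.cases_succ, Fintype.card_prod, Fintype.card_bool, if_true, Bool.false_eq_true,
        if_false]
      push_cast
      have hc : (Fintype.card Ω : 𝕜) * 2 * (a 0 * b 0) = ∑ ω : Ω, 2 * (a 0 * b 0) := by
        simp [mul_assoc]
      rw [mul_add, hc, mul_right_comm, ← this, Finset.sum_mul, ← Finset.sum_add_distrib]
      refine Finset.sum_congr rfl fun ω _ => ?_
      ring
    · intro a
      have := h2 (fun k => a k.succ)
      simp only [Fintype.sum_prod_type, Fintype.sum_bool, Fin.sum_univ_succ, Fin.cases_zero,
        Fin.cases_succ, Fintype.card_prod, Fintype.card_bool, if_true, Bool.false_eq_true,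
        if_false]
      have key : ∀ z w : 𝕜, ‖1 * z + w‖ ^ 2 + ‖-1 * z + w‖ ^ 2 = 2 * ‖z‖ ^ 2 + 2 * ‖w‖ ^ 2 := by
        intro z w
        have := parallelogram_law_with_norm 𝕜 w z
        rw [one_mul, neg_one_mul, add_comm z, neg_add_eq_sub]
        linarith
      simp only [key]
      rw [Finset.sum_add_distrib, ← Finset.mul_sum, ← Finset.mul_sum, this]
      simp only [Finset.sum_const, Finset.card_univ, nsmul_eq_mul]
      push_cast
      ring
    · intro a
      have e2 := h2 (fun k => a k.succ)
      have e4 := h4 (fun k => a k.succ)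
      simp only [Fintype.sum_prod_type, Fintype.sum_bool, Fin.sum_univ_succ, Fin.cases_zero,
        Fin.cases_succ, Fintype.card_prod, Fintype.card_bool, if_true, Bool.false_eq_true,
        if_false]
      have key : ∀ z w : 𝕜, ‖1 * z + w‖ ^ 4 + ‖-1 * z + w‖ ^ 4
          ≤ 2 * ‖z‖ ^ 4 + 12 * ‖z‖ ^ 2 * ‖w‖ ^ 2 + 2 * ‖w‖ ^ 4 := by
        intro z w
        have hp := parallelogram_law_with_norm 𝕜 w z
        have h5 : ‖1 * z + w‖ ≤ ‖w‖ + ‖z‖ := by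
          rw [one_mul, add_comm]; exact norm_add_le _ _
        have h6 : ‖-1 * z + w‖ ≤ ‖w‖ + ‖z‖ := by
          rw [neg_one_mul, neg_add_eq_sub]; exact norm_sub_le _ _
        rw [one_mul, neg_one_mul, add_comm z, neg_add_eq_sub] at *
        set p := ‖w + z‖ ^ 2 with hpdef
        set q := ‖w - z‖ ^ 2 with hqdef
        have hp2 : p ≤ (‖w‖ + ‖z‖) ^ 2 := pow_le_pow_left₀ (norm_nonneg _) h5 2
        have hq2 : q ≤ (‖w‖ + ‖z‖) ^ 2 := pow_le_pow_left₀ (norm_nonneg _) h6 2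
        have hs : p + q = 2 * (‖w‖ ^ 2 + ‖z‖ ^ 2) := by rw [hpdef, hqdef]; linarith
        have : ‖w + z‖ ^ 4 + ‖w - z‖ ^ 4 = p ^ 2 + q ^ 2 := by rw [hpdef, hqdef]; ring
        rw [this]
        have hq : q = 2 * (‖w‖ ^ 2 + ‖z‖ ^ 2) - p := by linarith
        -- With `p + q` fixed by the parallelogram law, this bounds `p q` below by `(‖w‖² - ‖z‖²)²`,
        -- hence `p² + q²` above.
        have h7 : 0 ≤ ((‖w‖ + ‖z‖) ^ 2 - p) * ((‖w‖ + ‖z‖) ^ 2 - q) :=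
          mul_nonneg (by linarith) (by linarith)
        rw [hq] at h7 ⊢
        nlinarith
      refine (Finset.sum_le_sum fun ω _ => key _ _).trans ?_
      rw [Finset.sum_add_distrib, Finset.sum_add_distrib, ← Finset.mul_sum, ← Finset.mul_sum,
        ← Finset.mul_sum, e2]
      simp only [Finset.sum_const, Finset.card_univ, nsmul_eq_mul]
      push_cast
      have hc : (0 : ℝ) ≤ Fintype.card Ω := by positivity
      have : 0 ≤ (Fintype.card Ω : ℝ) * ‖a 0‖ ^ 4 := by positivity
      nlinarith

/-- Cauchy–Schwarz for finite sums of scalars, with bounds on the square sums. -/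
theorem norm_sum_mul_le {𝕜 Ω : Type*} [RCLike 𝕜] [Fintype Ω] (x y : Ω → 𝕜) {α β : ℝ}
    (hα : 0 ≤ α) (hβ : 0 ≤ β) (hx : ∑ k, ‖x k‖ ^ 2 ≤ α ^ 2) (hy : ∑ k, ‖y k‖ ^ 2 ≤ β ^ 2) :
    ‖∑ k, x k * y k‖ ≤ α * β := by
  have h1 : ‖∑ k, x k * y k‖ ≤ ∑ k, ‖x k‖ * ‖y k‖ :=
    (norm_sum_le _ _).trans (by simp)
  refine h1.trans (abs_le_of_sq_le_sq' ?_ (by positivity)).2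
  calc _ ≤ (∑ k, ‖x k‖ ^ 2) * ∑ k, ‖y k‖ ^ 2 := Finset.sum_mul_sq_le_sq_mul_sq _ _ _
    _ ≤ α ^ 2 * β ^ 2 := by gcongr
    _ = _ := by ring

/-! ### Grothendieck's inequality -/

section Grothendieck

variable {𝕜 : Type*} [RCLike 𝕜] {ι κ : Type*} [Fintype ι] [Fintype κ]

/-- The matrix `t` acts with constant `B` on finite families of vectors of Euclidean spaces. -/
def VectorBound (t : ι → κ → 𝕜) (B : ℝ) : Prop :=
  ∀ (N : ℕ) (x : ι → Fin N → 𝕜) (y : κ → Fin N → 𝕜) (α β : ℝ), 0 < α → 0 < β →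
    (∀ i, ∑ k, ‖x i k‖ ^ 2 ≤ α ^ 2) → (∀ j, ∑ k, ‖y j k‖ ^ 2 ≤ β ^ 2) →
    ‖∑ i, ∑ j, t i j * ∑ k, x i k * y j k‖ ≤ B * (α * β)

theorem VectorBound.fintype {t : ι → κ → 𝕜} {B : ℝ} (h : VectorBound t B) {Ω : Type*} [Fintype Ω]
    (x : ι → Ω → 𝕜) (y : κ → Ω → 𝕜) {α β : ℝ} (hα : 0 < α) (hβ : 0 < β)
    (hx : ∀ i, ∑ k, ‖x i k‖ ^ 2 ≤ α ^ 2) (hy : ∀ j, ∑ k, ‖y j k‖ ^ 2 ≤ β ^ 2) :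
    ‖∑ i, ∑ j, t i j * ∑ k, x i k * y j k‖ ≤ B * (α * β) := by
  let e := (Fintype.equivFin Ω).symm
  have := h _ (fun i k => x i (e k)) (fun j k => y j (e k)) α β hα hβ
    (fun i => (e.sum_comp fun k => ‖x i k‖ ^ 2).trans_le (hx i))
    (fun i => (e.sum_comp fun k => ‖y i k‖ ^ 2).trans_le (hy i))
  convert this using 6 with i _ j _
  exact (e.sum_comp fun k => x i k * y j k).symm

/-- A crude finite constant, needed only to start the iteration of `VectorBound.improve`. -/
theorem vectorBound_sum_norm (t : ι → κ → 𝕜) : VectorBound t (∑ i, ∑ j, ‖t i j‖) := by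
  intro N x y α β hα hβ hx hy
  simp only [Finset.sum_mul]
  refine (norm_sum_le _ _).trans (Finset.sum_le_sum fun i _ => ?_)
  refine (norm_sum_le _ _).trans (Finset.sum_le_sum fun j _ => ?_)
  rw [norm_mul]
  gcongr
  exact norm_sum_mul_le _ _ hα.le hβ.le (hx i) (hy j)

/-- Truncating the coordinates at level `4 α`, when the fourth moment is controlled. -/
theorem exists_truncation {Ω : Type*} [Fintype Ω] (X : Ω → 𝕜) {α : ℝ} (hα : 0 < α)
    (h2 : ∑ ω, ‖X ω‖ ^ 2 ≤ Fintype.card Ω * α ^ 2)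
    (h4 : ∑ ω, ‖X ω‖ ^ 4 ≤ 3 * Fintype.card Ω * α ^ 4) :
    ∃ S R : Ω → 𝕜, (∀ ω, X ω = S ω + R ω) ∧ (∀ ω, ‖S ω‖ ≤ 4 * α) ∧
      ∑ ω, ‖S ω‖ ^ 2 ≤ Fintype.card Ω * α ^ 2 ∧
      ∑ ω, ‖R ω‖ ^ 2 ≤ Fintype.card Ω * (7 / 16 * α) ^ 2 := by
  refine ⟨fun ω => if ‖X ω‖ ≤ 4 * α then X ω else 0, fun ω => if ‖X ω‖ ≤ 4 * α then 0 else X ω,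
    fun ω => ?_, fun ω => ?_, ?_, ?_⟩
  · dsimp only; split_ifs <;> simp
  · dsimp only
    split_ifs with h
    · exact h
    · simp [hα.le]
  · refine (Finset.sum_le_sum fun ω _ => ?_).trans h2
    dsimp only
    split_ifs
    · exact le_rfl
    · simp
  -- Chebyshev: where `‖X‖ > 4α`, `‖X‖² · 16α² ≤ ‖X‖⁴`. The remainder thus has mean square at most
  -- `3α²/16`, and `3/16 = 48/256 ≤ (7/16)²`.
  · have : ∑ ω, ‖if ‖X ω‖ ≤ 4 * α then 0 else X ω‖ ^ 2 * (4 * α) ^ 2 ≤ ∑ ω, ‖X ω‖ ^ 4 := by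
      refine Finset.sum_le_sum fun ω _ => ?_
      split_ifs with h
      · simp
      · have h' : (4 * α) ^ 2 ≤ ‖X ω‖ ^ 2 := by
          have := not_le.1 h
          gcongr
        calc _ ≤ ‖X ω‖ ^ 2 * ‖X ω‖ ^ 2 := by gcongr
          _ = _ := by ring
    rw [← Finset.sum_mul] at this
    have h5 := this.trans h4
    have hα2 : 0 < 16 * α ^ 2 := by positivity
    refine le_of_mul_le_mul_right ?_ hα2
    have : 0 ≤ (Fintype.card Ω : ℝ) * α ^ 4 := by positivity
    nlinarith

/-- Random signs represent each inner product as the average of a product `X Y` of scalar functions.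
The truncated parts are bounded by `4α` and `4β`, so the scalar hypothesis applies pointwise and
gives `16`. The two error terms each contain a remainder of norm `7/16` times the original, so the
bound `B` itself handles them and returns only `7/8 B`. -/
theorem VectorBound.improve {t : ι → κ → 𝕜} {B : ℝ} (h : VectorBound t B)
    (ht : ∀ (s : ι → 𝕜) (r : κ → 𝕜), (∀ i, ‖s i‖ ≤ 1) → (∀ j, ‖r j‖ ≤ 1) →
      ‖∑ i, ∑ j, t i j * (s i * r j)‖ ≤ 1) :
    VectorBound t (16 + 7 / 8 * B) := by
  intro N x y α β hα hβ hx hy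
  obtain ⟨Ω, _, _, r, h1, h2, h4⟩ := exists_rademacher 𝕜 N
  set c : ℝ := ((Fintype.card Ω : ℕ) : ℝ) with hc
  have hc0 : 0 < c := by rw [hc]; exact_mod_cast Fintype.card_pos
  set X : ι → Ω → 𝕜 := fun i ω => ∑ k, r k ω * x i k
  set Y : κ → Ω → 𝕜 := fun j ω => ∑ k, r k ω * y j k
  have hX2 : ∀ i, ∑ ω, ‖X i ω‖ ^ 2 ≤ c * α ^ 2 := fun i => by
    rw [h2]; have := hx i; gcongr
  have hY2 : ∀ i, ∑ ω, ‖Y i ω‖ ^ 2 ≤ c * β ^ 2 := fun i => by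
    rw [h2]; have := hy i; gcongr
  have hX4 : ∀ i, ∑ ω, ‖X i ω‖ ^ 4 ≤ 3 * c * α ^ 4 := fun i => by
    refine (h4 _).trans ?_
    rw [show α ^ 4 = (α ^ 2) ^ 2 by ring]
    have := hx i; gcongr
  have hY4 : ∀ i, ∑ ω, ‖Y i ω‖ ^ 4 ≤ 3 * c * β ^ 4 := fun i => by
    refine (h4 _).trans ?_
    rw [show β ^ 4 = (β ^ 2) ^ 2 by ring]
    have := hy i; gcongr
  choose S R hXS hS hS2 hR2 using fun i => exists_truncation (X i) hα (hX2 i) (hX4 i)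
  choose S' R' hYS hS' hS2' hR2' using fun i => exists_truncation (Y i) hβ (hY2 i) (hY4 i)
  have hsq : (√c) ^ 2 = c := Real.sq_sqrt hc0.le
  have hsc : 0 < √c := Real.sqrt_pos.2 hc0
  have b1 : ‖∑ i, ∑ j, t i j * ∑ ω, S i ω * S' j ω‖ ≤ c * (16 * (α * β)) := by
    have e : ∑ i, ∑ j, t i j * ∑ ω, S i ω * S' j ω
        = ∑ ω, ∑ i, ∑ j, t i j * (S i ω * S' j ω) := by
      simp only [Finset.mul_sum]
      conv_rhs => rw [Finset.sum_comm]
      refine Finset.sum_congr rfl fun i _ => ?_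
      rw [Finset.sum_comm]
    rw [e]
    refine (norm_sum_le _ _).trans ?_
    have : ∀ ω ∈ Finset.univ, ‖∑ i, ∑ j, t i j * (S i ω * S' j ω)‖ ≤ 16 * (α * β) := by
      intro ω _
      have h4α : (0 : ℝ) < 4 * α := by positivity
      have h4β : (0 : ℝ) < 4 * β := by positivity
      have := ht (fun i => S i ω / (4 * α : ℝ)) (fun j => S' j ω / (4 * β : ℝ))
        (fun i => by
          rw [norm_div, RCLike.norm_ofReal, abs_of_pos h4α, div_le_one h4α]; exact hS i ω)
        (fun i => by
          rw [norm_div, RCLike.norm_ofReal, abs_of_pos h4β, div_le_one h4β]; exact hS' i ω)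
      have e2 : ∑ i, ∑ j, t i j * (S i ω * S' j ω) = ((16 * (α * β) : ℝ) : 𝕜) *
          ∑ i, ∑ j, t i j * (S i ω / (4 * α : ℝ) * (S' j ω / (4 * β : ℝ))) := by
        simp only [Finset.mul_sum]
        refine Finset.sum_congr rfl fun i _ => Finset.sum_congr rfl fun j _ => ?_
        have h1 : (α : 𝕜) ≠ 0 := by exact_mod_cast hα.ne'
        have h2 : (β : 𝕜) ≠ 0 := by exact_mod_cast hβ.ne'
        push_cast
        field_simp
        ring
      rw [e2, norm_mul, RCLike.norm_ofReal, abs_of_pos (by positivity)]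
      exact mul_le_of_le_one_right (by positivity) this
    refine (Finset.sum_le_card_nsmul _ _ _ this).trans ?_
    simp [hc]
  have b2 : ‖∑ i, ∑ j, t i j * ∑ ω, R i ω * Y j ω‖ ≤ B * (√c * (7 / 16 * α) * (√c * β)) :=
    h.fintype R Y (by positivity) (by positivity)
      (fun i => by rw [mul_pow, hsq]; exact hR2 i) (fun i => by rw [mul_pow, hsq]; exact hY2 i)
  have b3 : ‖∑ i, ∑ j, t i j * ∑ ω, S i ω * R' j ω‖ ≤ B * (√c * α * (√c * (7 / 16 * β))) :=
    h.fintype S R' (by positivity) (by positivity)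
      (fun i => by rw [mul_pow, hsq]; exact hS2 i) (fun i => by rw [mul_pow, hsq]; exact hR2' i)
  -- The splitting `X Y = S S' + R Y + S R'`, with just two error terms.
  have e3 : (c : 𝕜) * ∑ i, ∑ j, t i j * ∑ k, x i k * y j k
      = (∑ i, ∑ j, t i j * ∑ ω, S i ω * S' j ω) + (∑ i, ∑ j, t i j * ∑ ω, R i ω * Y j ω)
        + ∑ i, ∑ j, t i j * ∑ ω, S i ω * R' j ω := by
    simp only [Finset.mul_sum (Finset.univ : Finset ι), ← Finset.sum_add_distrib]
    refine Finset.sum_congr rfl fun i _ => ?_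
    simp only [Finset.mul_sum (Finset.univ : Finset κ)]
    refine Finset.sum_congr rfl fun j _ => ?_
    have := h1 (x i) (y j)
    rw [mul_left_comm, hc, RCLike.ofReal_natCast, ← this, ← mul_add, ← mul_add,
      ← Finset.sum_add_distrib, ← Finset.sum_add_distrib]
    congr 1
    refine Finset.sum_congr rfl fun ω _ => ?_
    change X i ω * Y j ω = _
    rw [hXS, hYS]
    ring
  have b4 : c * ‖∑ i, ∑ j, t i j * ∑ k, x i k * y j k‖ ≤ c * ((16 + 7 / 8 * B) * (α * β)) := by
    calc _ = ‖(c : 𝕜) * ∑ i, ∑ j, t i j * ∑ k, x i k * y j k‖ := by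
          rw [norm_mul, RCLike.norm_ofReal, abs_of_pos hc0]
      _ ≤ c * (16 * (α * β)) + B * (√c * (7 / 16 * α) * (√c * β))
          + B * (√c * α * (√c * (7 / 16 * β))) := by
          rw [e3]; exact norm_add_le_of_le (norm_add_le_of_le b1 b2) b3
      _ = c * (16 * (α * β)) + (√c) ^ 2 * (7 / 8 * B * (α * β)) := by ring
      _ = _ := by rw [hsq]; ring
  exact le_of_mul_le_mul_left b4 hc0

/-- Grothendieck's inequality, with the constant `128`. -/
theorem vectorBound_of_bilinear_le {t : ι → κ → 𝕜}
    (ht : ∀ (s : ι → 𝕜) (r : κ → 𝕜), (∀ i, ‖s i‖ ≤ 1) → (∀ j, ‖r j‖ ≤ 1) →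
      ‖∑ i, ∑ j, t i j * (s i * r j)‖ ≤ 1) : VectorBound t 128 := by
  set C := ∑ i, ∑ j, ‖t i j‖ with hC
  -- `128` is the fixed point of `B ↦ 16 + 7/8 B`, approached geometrically.
  have hn : ∀ n : ℕ, VectorBound t (128 + (7 / 8) ^ n * (C - 128)) := by
    intro n
    induction n with
    | zero => simpa using vectorBound_sum_norm t
    | succ n ih =>
      convert ih.improve ht using 1
      ring
  intro N x y α β hα hβ hx hy
  refine ge_of_tendsto' (f := fun n : ℕ => (128 + (7 / 8) ^ n * (C - 128)) * (α * β)) (x := atTop)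
    ?_ fun n => hn n N x y α β hα hβ hx hy
  have : Tendsto (fun n : ℕ => ((7 : ℝ) / 8) ^ n) atTop (𝓝 0) :=
    tendsto_pow_atTop_nhds_zero_of_lt_one (by norm_num) (by norm_num)
  simpa using ((this.mul_const (C - 128)).const_add 128).mul_const (α * β)

end Grothendieck

/-! ### Pietsch domination by Hahn–Banach separation -/

section Weights

variable {𝕜 : Type*} [RCLike 𝕜] {ι κ : Type*} [Fintype ι] [Fintype κ]

/-- A convex set of functions on a finite set containing `0` and no strictly negative function
is nonnegative on average for some probability weights. -/
theorem exists_weights {Λ : Type*} [Fintype Λ] [Nonempty Λ] {A : Set (Λ → ℝ)} (hA : Convex ℝ A)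
    (h0 : (0 : Λ → ℝ) ∈ A) (hneg : ∀ f ∈ A, ¬ ∀ i, f i < 0) :
    ∃ w : Λ → ℝ, (∀ i, 0 ≤ w i) ∧ ∑ i, w i = 1 ∧ ∀ f ∈ A, 0 ≤ ∑ i, w i * f i := by
  classical
  have hopen : IsOpen {f : Λ → ℝ | ∀ i, f i < 0} := by
    simp only [Set.ofPred_forall]
    exact isOpen_iInter_of_finite fun i => isOpen_lt (continuous_apply i) continuous_const
  have hconv : Convex ℝ {f : Λ → ℝ | ∀ i, f i < 0} := by
    simp only [Set.ofPred_forall]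
    exact convex_iInter fun i => convex_halfSpace_lt (LinearMap.proj i).isLinear 0
  -- The open cone of strictly negative functions misses `A`; the separating functional, normalised,
  -- supplies the weights.
  obtain ⟨g, u, hg, hu⟩ := geometric_hahn_banach_open hconv hopen hA
    (Set.disjoint_left.2 fun f hf hfA => hneg f hfA hf)
  have hu0 : u ≤ 0 := by simpa using hu 0 h0
  -- Shifting by `-ε` reaches the closed cone; applied to `-Pi.single i 1`, it makes the
  -- coefficients of `g` nonnegative.
  have hneg' : ∀ f : Λ → ℝ, (∀ i, f i ≤ 0) → g f ≤ 0 := by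
    intro f hf
    have ht : Tendsto (fun ε : ℝ => g (f - ε • (1 : Λ → ℝ))) (𝓝[>] 0) (𝓝 (g f)) := by
      have : Continuous fun ε : ℝ => g (f - ε • (1 : Λ → ℝ)) := by fun_prop
      simpa using (this.tendsto 0).mono_left nhdsWithin_le_nhds
    refine le_of_tendsto ht ?_
    filter_upwards [self_mem_nhdsWithin] with ε hε
    refine ((hg _ fun i => ?_).trans_le hu0).le
    have := hf i
    simp only [Pi.sub_apply, Pi.smul_apply, Pi.one_apply, smul_eq_mul, mul_one]
    linarith [Set.mem_Ioi.1 hε]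
  have hsum : ∀ f : Λ → ℝ, g f = ∑ i, g (Pi.single i 1) * f i := by
    intro f
    conv_lhs => rw [← Finset.univ_sum_single f]
    rw [map_sum]
    refine Finset.sum_congr rfl fun i _ => ?_
    rw [mul_comm, ← smul_eq_mul, ← map_smul, ← Pi.single_smul, smul_eq_mul, mul_one]
  have hpos : ∀ i, 0 ≤ g (Pi.single i 1) := by
    intro i
    have := hneg' (-Pi.single i 1) fun j => by
      by_cases h : j = i
      · subst h; simp
      · simp [h]
    rw [map_neg] at this
    linarith
  have hnegA : ∀ f ∈ A, 0 ≤ g f := by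
    have h0u : 0 ≤ u := by
      have ht : Tendsto (fun ε : ℝ => g (-(ε • (1 : Λ → ℝ)))) (𝓝[>] 0) (𝓝 0) := by
        have : Continuous fun ε : ℝ => g (-(ε • (1 : Λ → ℝ))) := by fun_prop
        simpa using (this.tendsto 0).mono_left nhdsWithin_le_nhds
      refine le_of_tendsto ht ?_
      filter_upwards [self_mem_nhdsWithin] with ε hε
      refine (hg _ fun i => ?_).le
      simpa using hε
    exact fun f hf => h0u.trans (hu f hf)
  have hone : 0 < ∑ i, g (Pi.single i 1) := by
    have := (hg (-1) fun i => by simp).trans_le hu0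
    rw [map_neg, hsum] at this
    simpa using this
  refine ⟨fun i => g (Pi.single i 1) / ∑ i, g (Pi.single i 1), fun i => div_nonneg (hpos i) hone.le,
    ?_, fun f hf => ?_⟩
  · rw [← Finset.sum_div, div_self hone.ne']
  · have := hnegA f hf
    rw [hsum] at this
    simp only [div_mul_eq_mul_div, ← Finset.sum_div]
    exact div_nonneg this hone.le

/-- Letting `ε → 0` in the bounds `α + ε`, `β + ε` admits zero bounds, which occur below as maxima
of possibly zero families. -/
theorem VectorBound.nonneg_form {t : ι → κ → 𝕜} {K : ℝ} (h : VectorBound t K)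
    {Ω : Type*} [Fintype Ω] (x : ι → Ω → 𝕜) (y : κ → Ω → 𝕜) {α β : ℝ} (hα : 0 ≤ α) (hβ : 0 ≤ β)
    (hx : ∀ i, ∑ k, ‖x i k‖ ^ 2 ≤ α ^ 2) (hy : ∀ j, ∑ k, ‖y j k‖ ^ 2 ≤ β ^ 2) :
    ‖∑ i, ∑ j, t i j * ∑ k, x i k * y j k‖ ≤ K * (α * β) := by
  have ht : Tendsto (fun ε : ℝ => K * ((α + ε) * (β + ε))) (𝓝[>] 0) (𝓝 (K * (α * β))) := by
    have : Continuous fun ε : ℝ => K * ((α + ε) * (β + ε)) := by fun_prop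
    simpa using (this.tendsto 0).mono_left nhdsWithin_le_nhds
  refine ge_of_tendsto ht ?_
  filter_upwards [self_mem_nhdsWithin] with ε hε
  have hε : 0 < ε := hε
  exact h.fintype x y (by positivity) (by positivity)
    (fun i => (hx i).trans (by gcongr; linarith)) (fun i => (hy i).trans (by gcongr; linarith))

/-- Pietsch domination on both sides for a matrix satisfying Grothendieck's inequality. -/
theorem VectorBound.exists_weights [Nonempty ι] [Nonempty κ] {t : ι → κ → 𝕜} {K : ℝ} (hK : 0 ≤ K)
    (h : VectorBound t K) :
    ∃ (μ : ι → ℝ) (ν : κ → ℝ), (∀ i, 0 ≤ μ i) ∧ (∀ j, 0 ≤ ν j) ∧ ∑ i, μ i = 1 ∧ ∑ j, ν j = 1 ∧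
      ∀ (x : ι → 𝕜) (y : κ → 𝕜), RCLike.re (∑ i, ∑ j, t i j * (x i * y j))
        ≤ K / 2 * (∑ i, μ i * ‖x i‖ ^ 2 + ∑ j, ν j * ‖y j‖ ^ 2) := by
  set F : (ι → 𝕜) × (κ → 𝕜) → ι × κ → ℝ := fun z p =>
    K / 2 * (‖z.1 p.1‖ ^ 2 + ‖z.2 p.2‖ ^ 2) - RCLike.re (∑ i, ∑ j, t i j * (z.1 i * z.2 j)) with hF
  obtain ⟨w, hw0, hw1, hw⟩ := SNumbers.exists_weights (convex_convexHull ℝ (Set.range F))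
    (subset_convexHull ℝ _ ⟨0, by ext; simp [hF]⟩) (by
      -- Scaling the `k`-th pair by `√(c k)` assembles a convex combination into one family of
      -- vectors. Their largest squared lengths are attained at `i₀` and `j₀`; the vector inequality
      -- and `√α2 √β2 ≤ (α2 + β2)/2` forbid negativity at `(i₀, j₀)`.
      intro f hf hneg
      obtain ⟨Ω, _, c, z, hc0, -, hz, rfl⟩ := mem_convexHull_iff_exists_fintype.1 hf
      choose q hq using hz
      obtain ⟨i₀, hi₀⟩ := Finite.exists_max fun i => ∑ k, c k * ‖(q k).1 i‖ ^ 2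
      obtain ⟨j₀, hj₀⟩ := Finite.exists_max fun j => ∑ k, c k * ‖(q k).2 j‖ ^ 2
      set α2 := ∑ k, c k * ‖(q k).1 i₀‖ ^ 2
      set β2 := ∑ k, c k * ‖(q k).2 j₀‖ ^ 2
      have hα2 : 0 ≤ α2 := Finset.sum_nonneg fun k _ => mul_nonneg (hc0 k) (by positivity)
      have hβ2 : 0 ≤ β2 := Finset.sum_nonneg fun k _ => mul_nonneg (hc0 k) (by positivity)
      have hn : ∀ k (v : 𝕜), ‖((√(c k) : ℝ) : 𝕜) * v‖ ^ 2 = c k * ‖v‖ ^ 2 := by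
        intro k v
        rw [norm_mul, mul_pow, RCLike.norm_ofReal, sq_abs, Real.sq_sqrt (hc0 k)]
      have key := h.nonneg_form (fun i k => ((√(c k) : ℝ) : 𝕜) * (q k).1 i)
        (fun j k => ((√(c k) : ℝ) : 𝕜) * (q k).2 j) (Real.sqrt_nonneg α2) (Real.sqrt_nonneg β2)
        (fun i => by simp only [hn]; rw [Real.sq_sqrt hα2]; exact hi₀ i)
        (fun i => by simp only [hn]; rw [Real.sq_sqrt hβ2]; exact hj₀ i)
      have e : ∑ i, ∑ j, t i j * ∑ k, ((√(c k) : ℝ) : 𝕜) * (q k).1 i *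
          (((√(c k) : ℝ) : 𝕜) * (q k).2 j)
          = ∑ k, (c k : 𝕜) * ∑ i, ∑ j, t i j * ((q k).1 i * (q k).2 j) := by
        simp only [Finset.mul_sum]
        conv_rhs => rw [Finset.sum_comm]
        refine Finset.sum_congr rfl fun i _ => ?_
        conv_rhs => rw [Finset.sum_comm]
        refine Finset.sum_congr rfl fun j _ => Finset.sum_congr rfl fun k _ => ?_
        have : (c k : 𝕜) = ((√(c k) : ℝ) : 𝕜) * ((√(c k) : ℝ) : 𝕜) := by
          rw [← RCLike.ofReal_mul, Real.mul_self_sqrt (hc0 k)]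
        rw [this]
        ring
      rw [e] at key
      have key2 := (RCLike.re_le_norm _).trans key
      rw [map_sum] at key2
      simp only [RCLike.re_ofReal_mul] at key2
      have hlt := hneg (i₀, j₀)
      simp only [Finset.sum_apply, Pi.smul_apply, smul_eq_mul, ← hq, hF, mul_sub,
        Finset.sum_sub_distrib] at hlt
      have e2 : ∑ k, c k * (K / 2 * (‖(q k).1 i₀‖ ^ 2 + ‖(q k).2 j₀‖ ^ 2))
          = K / 2 * (α2 + β2) := by
        rw [← Finset.sum_add_distrib, Finset.mul_sum]
        exact Finset.sum_congr rfl fun k _ => by ring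
      rw [e2] at hlt
      have : √α2 * √β2 ≤ (α2 + β2) / 2 := by
        have := two_mul_le_add_sq (√α2) (√β2)
        rw [Real.sq_sqrt hα2, Real.sq_sqrt hβ2] at this
        linarith
      have := mul_le_mul_of_nonneg_left this hK
      linarith)
  -- `F` is a sum of functions of one index minus a constant, so only the marginals of `w` matter.
  refine ⟨fun i => ∑ j, w (i, j), fun j => ∑ i, w (i, j),
    fun i => Finset.sum_nonneg fun j _ => hw0 _, fun i => Finset.sum_nonneg fun j _ => hw0 _,
    by rw [← hw1, Fintype.sum_prod_type], by rw [← hw1, Fintype.sum_prod_type_right],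
    fun x y => ?_⟩
  have := hw (F (x, y)) (subset_convexHull ℝ _ ⟨_, rfl⟩)
  simp only [hF, mul_sub, Finset.sum_sub_distrib] at this
  rw [← Finset.sum_mul, hw1, one_mul, sub_nonneg] at this
  refine this.trans_eq ?_
  simp only [mul_add, Finset.sum_add_distrib, Finset.mul_sum, Finset.sum_mul]
  congr 1
  · rw [Fintype.sum_prod_type]
    exact Finset.sum_congr rfl fun i _ => Finset.sum_congr rfl fun j _ => by ring
  · rw [Fintype.sum_prod_type_right]
    exact Finset.sum_congr rfl fun i _ => Finset.sum_congr rfl fun j _ => by ring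

end Weights

/-! ### Sequence spaces and diagonal operators -/

section Sequences

variable {𝕜 : Type*} [RCLike 𝕜]

theorem memℓp_two_iff {f : ℕ → 𝕜} : Memℓp f 2 ↔ Summable fun i => ‖f i‖ ^ 2 := by
  rw [memℓp_gen_iff (by norm_num)]
  simp

theorem memℓp_one_iff {f : ℕ → 𝕜} : Memℓp f 1 ↔ Summable fun i => ‖f i‖ := by
  rw [memℓp_gen_iff (by norm_num)]
  simp

theorem Ell2.summable_norm_sq (f : Ell2 𝕜) : Summable fun i => ‖f i‖ ^ 2 :=
  memℓp_two_iff.1 (lp.memℓp f)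

theorem Ell2.norm_sq_eq_tsum (f : Ell2 𝕜) : ‖f‖ ^ 2 = ∑' i, ‖f i‖ ^ 2 := by
  simpa using lp.norm_rpow_eq_tsum (p := 2) (by norm_num) f

theorem Ell1.norm_eq_tsum (f : Ell1 𝕜) : ‖f‖ = ∑' i, ‖f i‖ := by
  simpa using lp.norm_rpow_eq_tsum (p := 1) (by norm_num) f

theorem CZero.norm_apply_le (x : CZero 𝕜) (i : ℕ) : ‖x i‖ ≤ ‖x‖ :=
  BoundedContinuousFunction.norm_coe_le_norm x.toBCF i

theorem CZero.norm_le {x : CZero 𝕜} {C : ℝ} (hC : 0 ≤ C) : ‖x‖ ≤ C ↔ ∀ i, ‖x i‖ ≤ C :=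
  BoundedContinuousFunction.norm_le (f := x.toBCF) hC

/-- The finitely supported sequence agreeing with `x` on `s`. -/
noncomputable def CZero.ofFinset (s : Finset ℕ) (x : ℕ → 𝕜) : CZero 𝕜 where
  toFun i := if i ∈ s then x i else 0
  continuous_toFun := continuous_of_discreteTopology
  zero_at_infty' := by
    rw [cocompact_eq_cofinite]
    refine tendsto_const_nhds.congr' ?_
    filter_upwards [s.finite_toSet.compl_mem_cofinite] with i hi
    rw [if_neg (by simpa using hi)]

theorem CZero.ofFinset_apply (s : Finset ℕ) (x : ℕ → 𝕜) (i : ℕ) :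
    CZero.ofFinset s x i = if i ∈ s then x i else 0 := rfl

theorem CZero.coe_sum {ι : Type*} (s : Finset ι) (f : ι → CZero 𝕜) (i : ℕ) :
    (∑ k ∈ s, f k) i = ∑ k ∈ s, f k i := by
  classical
  induction s using Finset.induction_on with
  | empty => simp
  | insert k s hk ih => rw [Finset.sum_insert hk, Finset.sum_insert hk, ← ih]; rfl

theorem CZero.ofFinset_eq_sum (s : Finset ℕ) (x : ℕ → 𝕜) :
    CZero.ofFinset s x = ∑ i ∈ s, x i • CZero.ofFinset {i} (fun _ => (1 : 𝕜)) := by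
  ext k
  rw [CZero.coe_sum]
  simp [CZero.ofFinset_apply]

theorem CZero.tendsto_ofFinset (x : CZero 𝕜) :
    Tendsto (fun N => CZero.ofFinset (Finset.range N) x) atTop (𝓝 x) := by
  rw [Metric.tendsto_atTop]
  intro ε hε
  have hx : Tendsto (fun i => x i) atTop (𝓝 0) := by
    have := x.zero_at_infty'
    rwa [cocompact_eq_cofinite, Nat.cofinite_eq_atTop] at this
  obtain ⟨N, hN⟩ := (Metric.tendsto_atTop.1 hx) (ε / 2) (by positivity)
  refine ⟨N, fun n hn => lt_of_le_of_lt ?_ (half_lt_self hε)⟩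
  rw [dist_eq_norm, CZero.norm_le (by positivity)]
  intro i
  rw [ZeroAtInftyContinuousMap.sub_apply, CZero.ofFinset_apply]
  split_ifs with h
  · simpa using (half_pos hε).le
  · rw [Finset.mem_range, not_lt] at h
    have := hN i (hn.trans h)
    rw [dist_zero_right] at this
    simpa using this.le

/-- The diagonal operator `c_0 → ℓ_2` with diagonal `a`. -/
noncomputable def diagCZero (a : Ell2 𝕜) : CZero 𝕜 →L[𝕜] Ell2 𝕜 :=
  have hs (x : CZero 𝕜) (i : ℕ) : ‖a i * x i‖ ^ 2 ≤ ‖a i‖ ^ 2 * ‖x‖ ^ 2 := by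
    rw [norm_mul, mul_pow]
    gcongr
    exact x.norm_apply_le i
  have hm (x : CZero 𝕜) : Summable fun i => ‖a i * x i‖ ^ 2 :=
    (a.summable_norm_sq.mul_right (‖x‖ ^ 2)).of_nonneg_of_le (fun _ => by positivity) (hs x)
  LinearMap.mkContinuous
    { toFun x := (⟨fun i => a i * x i, memℓp_two_iff.2 (hm x)⟩ : Ell2 𝕜)
      map_add' x y := by ext i; exact mul_add _ _ _
      map_smul' c x := by ext i; exact mul_left_comm _ _ _ }
    ‖a‖ fun x => by
      refine abs_le_of_sq_le_sq' ?_ (by positivity) |>.2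
      rw [Ell2.norm_sq_eq_tsum, mul_pow, Ell2.norm_sq_eq_tsum a, ← tsum_mul_right]
      exact (hm x).tsum_le_tsum (hs x) (a.summable_norm_sq.mul_right (‖x‖ ^ 2))

theorem diagCZero_apply (a : Ell2 𝕜) (x : CZero 𝕜) (i : ℕ) : diagCZero a x i = a i * x i := rfl

/-- The diagonal operator `ℓ_2 → ℓ_1` with diagonal `b`. -/
noncomputable def diagEll1 (b : Ell2 𝕜) : Ell2 𝕜 →L[𝕜] Ell1 𝕜 :=
  have hpq : (2 : ENNReal).toReal.HolderConjugate (2 : ENNReal).toReal := by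
    simpa using Real.HolderConjugate.two_two
  have hm (x : Ell2 𝕜) : Summable fun i => ‖b i * x i‖ := by
    simpa using lp.summable_mul hpq b x
  LinearMap.mkContinuous
    { toFun x := (⟨fun i => b i * x i, memℓp_one_iff.2 (hm x)⟩ : Ell1 𝕜)
      map_add' x y := by ext i; exact mul_add _ _ _
      map_smul' c x := by ext i; exact mul_left_comm _ _ _ }
    ‖b‖ fun x => by
      rw [Ell1.norm_eq_tsum]
      refine le_trans (le_of_eq ?_) (lp.tsum_mul_le_mul_norm' hpq b x)
      exact tsum_congr fun i => norm_mul _ _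

theorem diagEll1_apply (b x : Ell2 𝕜) (i : ℕ) : diagEll1 b x i = b i * x i := rfl

theorem diagCZero_add (a a' : Ell2 𝕜) : diagCZero (a + a') = diagCZero a + diagCZero a' := by
  ext x i; exact add_mul _ _ _

theorem diagEll1_add (a a' : Ell2 𝕜) : diagEll1 (a + a') = diagEll1 a + diagEll1 a' := by
  ext x i; exact add_mul _ _ _

theorem denseRange_diagCZero {a : Ell2 𝕜} (ha : ∀ i, a i ≠ 0) : DenseRange (diagCZero a) := by
  intro f
  refine mem_closure_of_tendsto ((lp.hasSum_single (by norm_num) f).tendsto_sum_nat)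
    (Eventually.of_forall fun N => ⟨CZero.ofFinset (Finset.range N) fun i => (a i)⁻¹ * f i, ?_⟩)
  ext i
  rw [diagCZero_apply, CZero.ofFinset_apply, lp.coeFn_sum, Finset.sum_apply]
  simp only [lp.single_apply]
  rw [Finset.sum_pi_single]
  split_ifs
  · rw [mul_inv_cancel_left₀ (ha i)]
  · simp

end Sequences

/-! ### Domination for operators from `c_0` to `ℓ_1` -/

section Domination

variable {𝕜 : Type*} [RCLike 𝕜]

/-- The matrix entries of an operator from `c_0` to `ℓ_1`. -/
noncomputable def entry (T : CZero 𝕜 →L[𝕜] Ell1 𝕜) (i j : ℕ) : 𝕜 := T (CZero.ofFinset {i} fun _ => 1) j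

theorem apply_ofFinset (T : CZero 𝕜 →L[𝕜] Ell1 𝕜) (s : Finset ℕ) (x : ℕ → 𝕜) (j : ℕ) :
    T (CZero.ofFinset s x) j = ∑ i ∈ s, entry T i j * x i := by
  rw [CZero.ofFinset_eq_sum, map_sum, lp.coeFn_sum, Finset.sum_apply]
  refine Finset.sum_congr rfl fun i _ => ?_
  rw [map_smul, mul_comm]
  rfl

/-- Pairing `T x` in `ℓ_1` with a bounded `y`: this supplies the scalar hypothesis of Grothendieck's
inequality. -/
theorem norm_sum_entry_le (T : CZero 𝕜 →L[𝕜] Ell1 𝕜) (s : Finset ℕ) {x y : ℕ → 𝕜}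
    (hx : ∀ i, ‖x i‖ ≤ 1) (hy : ∀ j, ‖y j‖ ≤ 1) :
    ‖∑ i ∈ s, ∑ j ∈ s, entry T i j * (x i * y j)‖ ≤ ‖T‖ := by
  have e : ∑ i ∈ s, ∑ j ∈ s, entry T i j * (x i * y j)
      = ∑ j ∈ s, T (CZero.ofFinset s x) j * y j := by
    rw [Finset.sum_comm]
    refine Finset.sum_congr rfl fun j _ => ?_
    rw [apply_ofFinset, Finset.sum_mul]
    exact Finset.sum_congr rfl fun i _ => by ring
  rw [e]
  calc _ ≤ ∑ j ∈ s, ‖T (CZero.ofFinset s x) j‖ := by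
        refine (norm_sum_le _ _).trans (Finset.sum_le_sum fun j _ => ?_)
        rw [norm_mul]
        exact mul_le_of_le_one_right (norm_nonneg _) (hy j)
    _ ≤ ‖T (CZero.ofFinset s x)‖ := by
        rw [Ell1.norm_eq_tsum]
        exact (memℓp_one_iff.1 (lp.memℓp _)).sum_le_tsum _ fun _ _ => norm_nonneg _
    _ ≤ ‖T‖ * 1 := by
        refine T.le_opNorm_of_le ((CZero.norm_le zero_le_one).2 fun i => ?_)
        rw [CZero.ofFinset_apply]
        split_ifs
        · exact hx i
        · simp
    _ = ‖T‖ := mul_one _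

theorem exists_weights_range (T : CZero 𝕜 →L[𝕜] Ell1 𝕜) (n : ℕ) :
    ∃ μ ν : ℕ → ℝ, (∀ i, 0 ≤ μ i) ∧ (∀ i, 0 ≤ ν i) ∧ (∀ N, ∑ i ∈ Finset.range N, μ i ≤ 1) ∧
      (∀ N, ∑ i ∈ Finset.range N, ν i ≤ 1) ∧
      ∀ x y : ℕ → 𝕜, RCLike.re (∑ i ∈ Finset.range (n + 1), ∑ j ∈ Finset.range (n + 1),
          entry T i j * (x i * y j))
        ≤ 64 * (‖T‖ + 1) * (∑ i ∈ Finset.range (n + 1), μ i * ‖x i‖ ^ 2 +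
          ∑ j ∈ Finset.range (n + 1), ν j * ‖y j‖ ^ 2) := by
  -- Adding `1` allows normalisation even when `T = 0`; the factor `64` is `128 / 2`.
  set c : ℝ := ‖T‖ + 1 with hc
  have hc0 : 0 < c := by positivity
  have hV : VectorBound (fun i j : Fin (n + 1) => (c⁻¹ : 𝕜) * entry T i j) 128 := by
    refine vectorBound_of_bilinear_le fun s r hs hr => ?_
    set s' : ℕ → 𝕜 := fun i => if h : i < n + 1 then s ⟨i, h⟩ else 0 with hs'
    set r' : ℕ → 𝕜 := fun i => if h : i < n + 1 then r ⟨i, h⟩ else 0 with hr'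
    have := norm_sum_entry_le T (Finset.range (n + 1)) (x := s') (y := r')
      (fun i => by simp only [hs']; split_ifs <;> simp [hs])
      (fun i => by simp only [hr']; split_ifs <;> simp [hr])
    simp only [Finset.sum_range] at this
    simp only [hs', hr', Fin.is_lt, dif_pos, Fin.eta] at this
    simp only [mul_assoc, ← Finset.mul_sum]
    rw [norm_mul, norm_inv, RCLike.norm_ofReal, abs_of_pos hc0, inv_mul_le_iff₀ hc0]
    linarith
  obtain ⟨μ, ν, hμ, hν, hμ1, hν1, h⟩ := hV.exists_weights (by norm_num)
  have ext_sum : ∀ μ : Fin (n + 1) → ℝ, (∀ i, 0 ≤ μ i) → ∑ i, μ i = 1 →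
      ∀ N, ∑ i ∈ Finset.range N, (if h : i < n + 1 then μ ⟨i, h⟩ else 0) ≤ 1 := by
    intro μ hμ hμ1 N
    calc _ ≤ ∑ i ∈ Finset.range (max N (n + 1)), (if h : i < n + 1 then μ ⟨i, h⟩ else 0) := by
          refine Finset.sum_le_sum_of_subset_of_nonneg
            (Finset.range_mono (le_max_left _ _)) fun i _ _ => ?_
          split_ifs <;> simp [hμ]
      _ = ∑ i ∈ Finset.range (n + 1), (if h : i < n + 1 then μ ⟨i, h⟩ else 0) := by
          refine (Finset.sum_subset (Finset.range_mono (le_max_right _ _)) fun i _ hi => ?_).symm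
          rw [dif_neg (by simpa using hi)]
      _ = 1 := by
          rw [← hμ1, Finset.sum_range]
          simp only [Fin.is_lt, dif_pos, Fin.eta]
      _ ≤ 1 := le_rfl
  refine ⟨fun i => if h : i < n + 1 then μ ⟨i, h⟩ else 0,
    fun i => if h : i < n + 1 then ν ⟨i, h⟩ else 0, fun i => by dsimp only; split_ifs <;> simp [hμ],
    fun i => by dsimp only; split_ifs <;> simp [hν], ext_sum μ hμ hμ1, ext_sum ν hν hν1,
    fun x y => ?_⟩
  have := h (fun i => x i) (fun i => y i)
  simp only [Finset.sum_range, Fin.is_lt, dif_pos, Fin.eta]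
  simp only [mul_assoc (c⁻¹ : 𝕜), ← Finset.mul_sum] at this
  rw [← RCLike.ofReal_inv, RCLike.re_ofReal_mul, inv_mul_le_iff₀ hc0] at this
  linarith

theorem sum_range_eq_of_eq_zero {M : Type*} [AddCommMonoid M] {f g : ℕ → M} {N n : ℕ}
    (hN : N ≤ n) (hfg : ∀ i < N, f i = g i) (hf : ∀ i, N ≤ i → f i = 0) :
    ∑ i ∈ Finset.range n, f i = ∑ i ∈ Finset.range N, g i := by
  rw [← Finset.sum_subset (Finset.range_mono hN) fun i _ hi => hf i (by simpa using hi)]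
  exact Finset.sum_congr rfl fun i hi => hfg i (Finset.mem_range.1 hi)

/-- Two-sided Pietsch domination for operators from `c_0` to `ℓ_1`. -/
theorem exists_domination (T : CZero 𝕜 →L[𝕜] Ell1 𝕜) :
    ∃ μ ν : ℕ → ℝ, (∀ i, 0 ≤ μ i) ∧ (∀ i, 0 ≤ ν i) ∧ Summable μ ∧ Summable ν ∧
      ∀ (N : ℕ) (x y : ℕ → 𝕜), RCLike.re (∑ i ∈ Finset.range N, ∑ j ∈ Finset.range N,
          entry T i j * (x i * y j))
        ≤ 64 * (‖T‖ + 1) * (∑ i ∈ Finset.range N, μ i * ‖x i‖ ^ 2 +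
          ∑ j ∈ Finset.range N, ν j * ‖y j‖ ^ 2) := by
  choose μ ν hμ hν hμ1 hν1 h using exists_weights_range T
  have hle : ∀ μ : ℕ → ℝ, (∀ i, 0 ≤ μ i) → (∀ N, ∑ i ∈ Finset.range N, μ i ≤ 1) →
      ∀ i, μ i ≤ 1 := fun μ hμ hμ1 i =>
    (Finset.single_le_sum (fun j _ => hμ j) (Finset.self_mem_range_succ i)).trans (hμ1 (i + 1))
  -- Coordinatewise limits of the finite weights may lose mass, but partial sums stay at most `1`,
  -- which is enough for summability.
  have hcomp : IsCompact ((Set.univ.pi fun _ : ℕ => Set.Icc (0 : ℝ) 1) ×ˢ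
      (Set.univ.pi fun _ : ℕ => Set.Icc (0 : ℝ) 1)) :=
    (isCompact_univ_pi fun _ => isCompact_Icc).prod (isCompact_univ_pi fun _ => isCompact_Icc)
  obtain ⟨⟨μ', ν'⟩, -, φ, hφ, hlim⟩ := hcomp.tendsto_subseq (x := fun n => (μ n, ν n))
    fun n => ⟨fun i _ => ⟨hμ n i, hle _ (hμ n) (hμ1 n) i⟩,
      fun i _ => ⟨hν n i, hle _ (hν n) (hν1 n) i⟩⟩
  have hlimμ : ∀ i, Tendsto (fun n => μ (φ n) i) atTop (𝓝 (μ' i)) :=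
    tendsto_pi_nhds.1 ((continuous_fst.tendsto _).comp hlim)
  have hlimν : ∀ i, Tendsto (fun n => ν (φ n) i) atTop (𝓝 (ν' i)) :=
    tendsto_pi_nhds.1 ((continuous_snd.tendsto _).comp hlim)
  have hμ0 : ∀ i, 0 ≤ μ' i := fun i => ge_of_tendsto' (hlimμ i) fun n => hμ _ i
  have hν0 : ∀ i, 0 ≤ ν' i := fun i => ge_of_tendsto' (hlimν i) fun n => hν _ i
  refine ⟨μ', ν', hμ0, hν0,
    summable_of_sum_range_le hμ0 fun N => le_of_tendsto'
      (tendsto_finsetSum _ fun i _ => hlimμ i) fun n => hμ1 _ N,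
    summable_of_sum_range_le hν0 fun N => le_of_tendsto'
      (tendsto_finsetSum _ fun i _ => hlimν i) fun n => hν1 _ N, fun N x y => ?_⟩
  have hl : Tendsto (fun n => 64 * (‖T‖ + 1) * (∑ i ∈ Finset.range N, μ (φ n) i * ‖x i‖ ^ 2 +
          ∑ j ∈ Finset.range N, ν (φ n) j * ‖y j‖ ^ 2)) atTop
      (𝓝 (64 * (‖T‖ + 1) * (∑ i ∈ Finset.range N, μ' i * ‖x i‖ ^ 2 +
          ∑ j ∈ Finset.range N, ν' j * ‖y j‖ ^ 2))) :=
    ((tendsto_finsetSum _ fun i _ => (hlimμ i).mul_const _).add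
      (tendsto_finsetSum _ fun i _ => (hlimν i).mul_const _)).const_mul _
  refine ge_of_tendsto hl ?_
  filter_upwards [eventually_ge_atTop N] with n hn
  have hN : N ≤ φ n + 1 := (hn.trans (hφ.id_le n)).trans (Nat.le_succ _)
  -- Extending by zero beyond `N` turns the inequality of size `φ n + 1` into one of fixed size `N`.
  have key := h (φ n) (fun i => if i < N then x i else 0) (fun i => if i < N then y i else 0)
  rw [sum_range_eq_of_eq_zero hN (g := fun i => ∑ j ∈ Finset.range N, entry T i j * (x i * y j))
      (fun i hi => sum_range_eq_of_eq_zero hN (fun j hj => by simp [hi, hj])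
        fun j hj => by simp [hj.not_gt]) (fun i hi => Finset.sum_eq_zero fun j _ => by
          simp [hi.not_gt]),
    sum_range_eq_of_eq_zero hN (g := fun i => μ (φ n) i * ‖x i‖ ^ 2)
      (fun i hi => by simp [hi]) (fun i hi => by simp [hi.not_gt]),
    sum_range_eq_of_eq_zero hN (g := fun i => ν (φ n) i * ‖y i‖ ^ 2)
      (fun i hi => by simp [hi]) (fun i hi => by simp [hi.not_gt])] at key
  exact key

end Domination

/-! ### Factorization through `ℓ_2` -/

section Factorization

variable {𝕜 : Type*} [RCLike 𝕜]

/-- A nonnegative summable sequence lies below the squares of a positive sequence of `ℓ_2`. -/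
theorem exists_ell2_dominating (𝕜 : Type*) [RCLike 𝕜] {μ : ℕ → ℝ} (hμ0 : ∀ i, 0 ≤ μ i)
    (hμ : Summable μ) : ∃ a : Ell2 𝕜, (∀ i, a i ≠ 0) ∧ ∀ i, μ i ≤ ‖a i‖ ^ 2 := by
  -- The summable term `2⁻ⁱ` keeps all entries nonzero: `b` must be inverted, and `D_a` must have
  -- dense range.
  have hpos : ∀ i, 0 < μ i + (1 / 2) ^ i := fun i => by have := hμ0 i; positivity
  have hn : ∀ i, ‖((√(μ i + (1 / 2) ^ i) : ℝ) : 𝕜)‖ ^ 2 = μ i + (1 / 2) ^ i := fun i => by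
    rw [RCLike.norm_ofReal, sq_abs, Real.sq_sqrt (hpos i).le]
  have hs : Summable fun i => ‖((√(μ i + (1 / 2) ^ i) : ℝ) : 𝕜)‖ ^ 2 := by
    simp only [hn]
    exact hμ.add summable_geometric_two
  refine ⟨⟨fun i => ((√(μ i + (1 / 2) ^ i) : ℝ) : 𝕜), memℓp_two_iff.2 hs⟩, fun i => ?_, fun i => ?_⟩
  · have : √(μ i + (1 / 2) ^ i) ≠ 0 := (Real.sqrt_pos.2 (hpos i)).ne'
    exact RCLike.ofReal_ne_zero.2 this
  · change _ ≤ ‖((√(μ i + (1 / 2) ^ i) : ℝ) : 𝕜)‖ ^ 2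
    rw [hn]
    have : (0 : ℝ) ≤ (1 / 2) ^ i := by positivity
    linarith

/-- Domination is additive in `x` and `y`; choosing `y` optimally for a given `x` turns it into a
bound of `D_b⁻¹ T x` by `D_a x`. -/
theorem sum_norm_sq_div_le (T : CZero 𝕜 →L[𝕜] Ell1 𝕜) {a b : Ell2 𝕜} (hb : ∀ i, b i ≠ 0)
    {K : ℝ} (hK : 0 < K)
    (h : ∀ (N : ℕ) (x y : ℕ → 𝕜), RCLike.re (∑ i ∈ Finset.range N, ∑ j ∈ Finset.range N,
          entry T i j * (x i * y j))
        ≤ K * (∑ i ∈ Finset.range N, ‖a i‖ ^ 2 * ‖x i‖ ^ 2 +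
          ∑ j ∈ Finset.range N, ‖b j‖ ^ 2 * ‖y j‖ ^ 2)) (x : CZero 𝕜) (M : ℕ) :
    ∑ j ∈ Finset.range M, ‖(b j)⁻¹ * T x j‖ ^ 2 ≤ (2 * K * ‖diagCZero a x‖) ^ 2 := by
  have step : ∀ y : ℕ → 𝕜, RCLike.re (∑ j ∈ Finset.range M, T x j * y j)
      ≤ K * (‖diagCZero a x‖ ^ 2 + ∑ j ∈ Finset.range M, ‖b j‖ ^ 2 * ‖y j‖ ^ 2) := by
    intro y
    have hx := CZero.tendsto_ofFinset x
    have hT : Tendsto (fun N => RCLike.re (∑ j ∈ Finset.range M,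
        T (CZero.ofFinset (Finset.range N) x) j * y j)) atTop
        (𝓝 (RCLike.re (∑ j ∈ Finset.range M, T x j * y j))) := by
      refine (RCLike.continuous_re.tendsto _).comp (tendsto_finsetSum _ fun j _ => ?_)
      refine Tendsto.mul_const _ ?_
      have hc : Continuous fun f : Ell1 𝕜 => f j :=
        (continuous_apply j).comp (lp.uniformContinuous_coe.continuous)
      exact ((hc.comp T.continuous).tendsto x).comp hx
    have hD : Tendsto (fun N => K * (‖diagCZero a (CZero.ofFinset (Finset.range N) x)‖ ^ 2 +
        ∑ j ∈ Finset.range M, ‖b j‖ ^ 2 * ‖y j‖ ^ 2)) atTop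
        (𝓝 (K * (‖diagCZero a x‖ ^ 2 + ∑ j ∈ Finset.range M, ‖b j‖ ^ 2 * ‖y j‖ ^ 2))) := by
      have : Continuous fun z => K * (‖diagCZero a z‖ ^ 2 +
        ∑ j ∈ Finset.range M, ‖b j‖ ^ 2 * ‖y j‖ ^ 2) := by fun_prop
      exact (this.tendsto x).comp hx
    refine le_of_tendsto_of_tendsto hT hD ?_
    filter_upwards [eventually_ge_atTop M] with N hN
    have key := h N x (fun j => if j < M then y j else 0)
    rw [Finset.sum_comm, sum_range_eq_of_eq_zero hN
        (g := fun j => T (CZero.ofFinset (Finset.range N) x) j * y j)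
        (fun j hj => by
          rw [apply_ofFinset, Finset.sum_mul]
          exact Finset.sum_congr rfl fun i _ => by rw [if_pos hj, mul_assoc])
        (fun j hj => Finset.sum_eq_zero fun i _ => by simp [hj.not_gt]),
      sum_range_eq_of_eq_zero (f := fun j => ‖b j‖ ^ 2 * ‖if j < M then y j else 0‖ ^ 2) hN
        (g := fun j => ‖b j‖ ^ 2 * ‖y j‖ ^ 2)
        (fun i hi => by simp [hi]) (fun i hi => by simp [hi.not_gt])] at key
    refine key.trans ?_
    gcongr
    rw [Ell2.norm_sq_eq_tsum]
    refine le_trans (le_of_eq ?_) ((Ell2.summable_norm_sq _).sum_le_tsum (Finset.range N)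
      fun _ _ => by positivity)
    refine Finset.sum_congr rfl fun i hi => ?_
    rw [diagCZero_apply, CZero.ofFinset_apply, if_pos hi, norm_mul, mul_pow]
  set V := ∑ j ∈ Finset.range M, ‖(b j)⁻¹ * T x j‖ ^ 2 with hV
  -- This maximises `s V - K s² V`, and yields `V ≤ 4 K² ‖D_a x‖²`.
  set s : ℝ := 1 / (2 * K) with hs
  have key := step fun j => (s : 𝕜) * ((starRingEnd 𝕜) ((b j)⁻¹ * T x j) * (b j)⁻¹)
  have e1 : ∑ j ∈ Finset.range M, T x j *
      ((s : 𝕜) * ((starRingEnd 𝕜) ((b j)⁻¹ * T x j) * (b j)⁻¹)) = ((s * V : ℝ) : 𝕜) := by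
    rw [hV, Finset.mul_sum]
    push_cast
    refine Finset.sum_congr rfl fun j _ => ?_
    rw [← RCLike.conj_mul]
    ring
  have e2 : ∑ j ∈ Finset.range M, ‖b j‖ ^ 2 *
      ‖(s : 𝕜) * ((starRingEnd 𝕜) ((b j)⁻¹ * T x j) * (b j)⁻¹)‖ ^ 2 = s ^ 2 * V := by
    rw [hV, Finset.mul_sum]
    refine Finset.sum_congr rfl fun j _ => ?_
    rw [norm_mul, norm_mul, RCLike.norm_conj, RCLike.norm_ofReal, norm_inv, mul_pow, sq_abs,
      mul_pow, inv_pow]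
    have : ‖b j‖ ≠ 0 := norm_ne_zero_iff.2 (hb j)
    field_simp
  rw [e1, e2, RCLike.ofReal_re, hs] at key
  have e3 : K * (‖diagCZero a x‖ ^ 2 + (1 / (2 * K)) ^ 2 * V)
      = K * ‖diagCZero a x‖ ^ 2 + V / (4 * K) := by
    field_simp
    ring
  rw [e3, one_div, inv_mul_eq_div] at key
  have e4 : V / (2 * K) = V / (4 * K) + V / (4 * K) := by field_simp; ring
  have e5 : V / (4 * K) ≤ K * ‖diagCZero a x‖ ^ 2 := by linarith
  rw [div_le_iff₀ (by positivity)] at e5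
  linarith

/-- Grothendieck's factorization: every operator from `c_0` to `ℓ_1` factors through `ℓ_2` by
diagonal operators. -/
theorem exists_factorization (T : CZero 𝕜 →L[𝕜] Ell1 𝕜) :
    ∃ (a b : Ell2 𝕜) (B : Ell2 𝕜 →L[𝕜] Ell2 𝕜), T = diagEll1 b ∘L B ∘L diagCZero a := by
  obtain ⟨μ, ν, hμ0, hν0, hμ, hν, h⟩ := exists_domination T
  obtain ⟨a, ha, haμ⟩ := exists_ell2_dominating 𝕜 hμ0 hμ
  obtain ⟨b, hb, hbν⟩ := exists_ell2_dominating 𝕜 hν0 hν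
  set K := 64 * (‖T‖ + 1)
  have hK : 0 < K := by positivity
  have hV := sum_norm_sq_div_le T (a := a) hb hK fun N x y => (h N x y).trans <| by
    gcongr with i _ i _
    · exact haμ i
    · exact hbν i
  have hm (x : CZero 𝕜) : Summable fun j => ‖(b j)⁻¹ * T x j‖ ^ 2 :=
    summable_of_sum_range_le (fun _ => by positivity) (hV x)
  -- `R = D_b⁻¹ T` is controlled by `D_a`, so `D_a x ↦ R x` is well defined and bounded on a dense
  -- subspace; `B` is its extension.
  let R : CZero 𝕜 →ₗ[𝕜] Ell2 𝕜 :=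
    { toFun x := ⟨fun j => (b j)⁻¹ * T x j, memℓp_two_iff.2 (hm x)⟩
      map_add' x y := by
        ext j
        change (b j)⁻¹ * T (x + y) j = (b j)⁻¹ * T x j + (b j)⁻¹ * T y j
        rw [map_add]
        exact mul_add _ _ _
      map_smul' c x := by
        ext j
        change (b j)⁻¹ * T (c • x) j = c * ((b j)⁻¹ * T x j)
        rw [map_smul]
        exact mul_left_comm _ _ _ }
  have hR (x : CZero 𝕜) : ‖R x‖ ≤ 2 * K * ‖diagCZero a x‖ := by
    refine abs_le_of_sq_le_sq' ?_ (by positivity) |>.2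
    rw [Ell2.norm_sq_eq_tsum]
    exact Real.tsum_le_of_sum_range_le (fun _ => by positivity) (hV x)
  refine ⟨a, b, R.extendOfNorm (diagCZero a : CZero 𝕜 →ₗ[𝕜] Ell2 𝕜), ?_⟩
  ext x j
  have := LinearMap.extendOfNorm_eq (f := R) (e := (diagCZero a : CZero 𝕜 →ₗ[𝕜] Ell2 𝕜))
    (denseRange_diagCZero ha) ⟨2 * K, hR⟩ x
  change _ = b j * (R.extendOfNorm (diagCZero a : CZero 𝕜 →ₗ[𝕜] Ell2 𝕜)
    ((diagCZero a : CZero 𝕜 →ₗ[𝕜] Ell2 𝕜) x)) j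
  rw [this]
  exact (mul_inv_cancel_left₀ (hb j) _).symm

end Factorization

/-! ### Low-rank approximation of Hilbert–Schmidt operators -/

section Greedy

variable {𝕜 : Type*} [RCLike 𝕜] {H H' : Type*} [NormedAddCommGroup H] [InnerProductSpace 𝕜 H]
  [NormedAddCommGroup H'] [InnerProductSpace 𝕜 H']

/-- An operator with Hilbert–Schmidt norm at most `σ` is within `σ / √(k + 1)` of its restriction
to a subspace of dimension at most `k`. -/
theorem exists_norm_sub_comp_starProjection_le (A : H →L[𝕜] H') {σ : ℝ} (hσ : 0 ≤ σ)
    (hA : ∀ (k : ℕ) (e : Fin k → H), Orthonormal 𝕜 e → ∑ i, ‖A (e i)‖ ^ 2 ≤ σ ^ 2) (k : ℕ) :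
    ∃ (U : Submodule 𝕜 H) (_ : FiniteDimensional 𝕜 U), Module.finrank 𝕜 U ≤ k ∧
      ‖A - A ∘L U.starProjection‖ ≤ σ / √(k + 1 : ℝ) := by
  by_contra! hcon
  set c := σ / √(k + 1 : ℝ) with hc
  have hc0 : 0 ≤ c := by positivity
  -- If no subspace works, orthonormal vectors with `‖A e‖ > c` can be added until there are `k +
  -- 1`, and their squares sum to more than `(k + 1) c² = σ²`.
  have main : ∀ j ≤ k + 1, ∃ e : Fin j → H, Orthonormal 𝕜 e ∧ ∀ i, c < ‖A (e i)‖ := by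
    intro j
    induction j with
    | zero => exact fun _ => ⟨Fin.elim0, ⟨fun i => i.elim0, fun i => i.elim0⟩, fun i => i.elim0⟩
    | succ j ih =>
      intro hj
      obtain ⟨e, he, hce⟩ := ih (by omega)
      set U := Submodule.span 𝕜 (Set.range e) with hU
      have hfin : FiniteDimensional 𝕜 U := FiniteDimensional.span_of_finite 𝕜 (Set.finite_range e)
      have hrank : Module.finrank 𝕜 U ≤ k :=
        (finrank_range_le_card e).trans (by simp; omega)
      obtain ⟨x, hx1, hx⟩ :=
        ContinuousLinearMap.exists_lt_apply_of_lt_opNorm _ (hcon U hfin hrank)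
      -- The new direction is orthogonal to the earlier ones, and since `‖w‖ ≤ 1`, normalising it
      -- only enlarges `‖A w‖`.
      set w := x - U.starProjection x with hw
      have hwA : (A - A ∘L U.starProjection) x = A w := by simp [hw]
      rw [hwA] at hx
      have hw1 : ‖w‖ ≤ 1 := by
        have h1 : ‖w‖ ≤ ‖x‖ := by
          have := Uᗮ.norm_starProjection_apply_le x
          rwa [Submodule.starProjection_orthogonal_val] at this
        exact h1.trans hx1.le
      have hw0 : 0 < ‖w‖ := by
        rw [norm_pos_iff]
        intro h
        rw [h, map_zero, norm_zero] at hx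
        exact absurd hx (not_lt.2 hc0)
      have horth : ∀ i, inner 𝕜 w (e i) = 0 := fun i => by
        have hmem : w ∈ Uᗮ := U.sub_starProjection_mem_orthogonal x
        exact (Submodule.mem_orthogonal' U w).1 hmem _ (Submodule.subset_span ⟨i, rfl⟩)
      refine ⟨Matrix.vecCons (((‖w‖⁻¹ : ℝ) : 𝕜) • w) e, orthonormal_vecCons_iff.2 ⟨?_, ?_, he⟩, ?_⟩
      · rw [norm_smul, RCLike.norm_ofReal, abs_of_pos (inv_pos.2 hw0), inv_mul_cancel₀ hw0.ne']
      · intro i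
        rw [inner_smul_left, horth, mul_zero]
      · intro i
        refine Fin.cases ?_ (fun i => by simpa using hce i) i
        rw [Matrix.cons_val_zero, map_smul, norm_smul, RCLike.norm_ofReal,
          abs_of_pos (inv_pos.2 hw0)]
        exact hx.trans_le (le_mul_of_one_le_left (norm_nonneg _) ((one_le_inv₀ hw0).2 hw1))
  obtain ⟨e, he, hce⟩ := main (k + 1) le_rfl
  have h1 : ∑ _i : Fin (k + 1), c ^ 2 < ∑ i, ‖A (e i)‖ ^ 2 :=
    Finset.sum_lt_sum_of_nonempty Finset.univ_nonempty fun i _ => by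
      have := hce i; gcongr
  have h2 : ∑ _i : Fin (k + 1), c ^ 2 = σ ^ 2 := by
    rw [Finset.sum_const, Finset.card_univ, Fintype.card_fin, nsmul_eq_mul, hc, div_pow,
      Real.sq_sqrt (by positivity)]
    push_cast
    field_simp
  exact absurd (hA _ e he) (not_le.2 (h2 ▸ h1))

end Greedy

/-! ### Calculus of finite-rank approximation -/

section FiniteRank

variable {𝕜 : Type*} [RCLike 𝕜]
  {X : Type*} [NormedAddCommGroup X] [NormedSpace 𝕜 X]
  {Y : Type*} [NormedAddCommGroup Y] [NormedSpace 𝕜 Y]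

/-- `T` is within `c` of an operator of rank at most `n`. -/
def RankApprox (n : ℕ) (c : ℝ) (T : X →L[𝕜] Y) : Prop :=
  ∃ S : X →L[𝕜] Y, LinearMap.rank (S : X →ₗ[𝕜] Y) ≤ (n : Cardinal) ∧ ‖T - S‖ ≤ c

theorem RankApprox.approxNumber_le {n m : ℕ} {c : ℝ} {T : X →L[𝕜] Y} (h : RankApprox n c T)
    (hm : n < m) : approxNumber m T ≤ c := by
  obtain ⟨S, hS, hc⟩ := h
  exact ((approxNumber_isGLB (by omega) T).1
    ⟨S, hS.trans_lt (by exact_mod_cast hm), rfl⟩).trans hc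

theorem RankApprox.add_rank {n m : ℕ} {c : ℝ} {T F : X →L[𝕜] Y} (h : RankApprox n c T)
    (hF : LinearMap.rank (F : X →ₗ[𝕜] Y) ≤ (m : Cardinal)) : RankApprox (m + n) c (F + T) := by
  obtain ⟨S, hS, hc⟩ := h
  refine ⟨F + S, ?_, by rwa [add_sub_add_left_eq_sub]⟩
  rw [Nat.cast_add]
  exact (LinearMap.rank_add_le _ _).trans (add_le_add hF hS)

end FiniteRank

section FiniteRankComp

universe u

variable {𝕜 : Type*} [RCLike 𝕜] {X Y Z : Type u} [NormedAddCommGroup X] [NormedSpace 𝕜 X]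
  [NormedAddCommGroup Y] [NormedSpace 𝕜 Y] [NormedAddCommGroup Z] [NormedSpace 𝕜 Z]

theorem RankApprox.comp_left {n : ℕ} {c : ℝ} {T : X →L[𝕜] Y} (h : RankApprox n c T)
    (R : Y →L[𝕜] Z) : RankApprox n (‖R‖ * c) (R ∘L T) := by
  obtain ⟨S, hS, hc⟩ := h
  refine ⟨R ∘L S, (LinearMap.rank_comp_le_right (S : X →ₗ[𝕜] Y) (R : Y →ₗ[𝕜] Z)).trans hS, ?_⟩
  rw [← ContinuousLinearMap.comp_sub]
  exact (ContinuousLinearMap.opNorm_comp_le _ _).trans (by gcongr)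

theorem RankApprox.comp_right {n : ℕ} {c : ℝ} {R : Y →L[𝕜] Z} (h : RankApprox n c R)
    (T : X →L[𝕜] Y) : RankApprox n (c * ‖T‖) (R ∘L T) := by
  obtain ⟨S, hS, hc⟩ := h
  refine ⟨S ∘L T, (LinearMap.rank_comp_le_left (T : X →ₗ[𝕜] Y) (S : Y →ₗ[𝕜] Z)).trans hS, ?_⟩
  rw [← ContinuousLinearMap.sub_comp]
  exact (ContinuousLinearMap.opNorm_comp_le _ _).trans (by gcongr)

/-- The errors multiply because `R A - (S' (A - S) + R S) = (R - S')(A - S)`, while the ranks only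
add. -/
theorem RankApprox.comp {n m : ℕ} {c d : ℝ} {A : X →L[𝕜] Y} {R : Y →L[𝕜] Z}
    (h : RankApprox n c A) (h' : RankApprox m d R) : RankApprox (m + n) (d * c) (R ∘L A) := by
  obtain ⟨S, hS, hc⟩ := h
  obtain ⟨S', hS', hd⟩ := h'
  have e : R ∘L A = S' ∘L (A - S) + R ∘L S + (R - S') ∘L (A - S) := by
    ext x; simp; abel
  refine ⟨S' ∘L (A - S) + R ∘L S, ?_, ?_⟩
  · rw [Nat.cast_add]
    refine (LinearMap.rank_add_le (S' ∘L (A - S) : X →L[𝕜] Z).toLinearMap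
      (R ∘L S : X →L[𝕜] Z).toLinearMap).trans (add_le_add ?_ ?_)
    · exact (LinearMap.rank_comp_le_left (A - S : X →L[𝕜] Y).toLinearMap S'.toLinearMap).trans hS'
    · exact (LinearMap.rank_comp_le_right S.toLinearMap R.toLinearMap).trans hS
  · rw [e, add_sub_cancel_left]
    refine (ContinuousLinearMap.opNorm_comp_le _ _).trans ?_
    gcongr
    exact (norm_nonneg _).trans hd

theorem rank_le_of_forall_eq_sum {f : X →ₗ[𝕜] Y} {n : ℕ} {v : ℕ → Y} {c : X → ℕ → 𝕜}
    (h : ∀ x, f x = ∑ i ∈ Finset.range n, c x i • v i) : LinearMap.rank f ≤ (n : Cardinal) := by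
  classical
  have hle : LinearMap.range f ≤ Submodule.span 𝕜 ((Finset.range n).image v : Set Y) := by
    rintro _ ⟨x, rfl⟩
    rw [h]
    exact Submodule.sum_mem _ fun i hi => Submodule.smul_mem _ _
      (Submodule.subset_span (Finset.mem_coe.2 (Finset.mem_image_of_mem v hi)))
  refine (Submodule.rank_mono hle).trans ((rank_span_finset_le _).trans ?_)
  have : ((Finset.range n).image v).card ≤ n := by
    simpa using Finset.card_image_le (s := Finset.range n) (f := v)
  exact_mod_cast this

end FiniteRankComp

/-! ### Hilbert–Schmidt bounds as rank approximation -/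

section HilbertSchmidt

universe u

variable {𝕜 : Type*} [RCLike 𝕜] {H H' : Type u}
  [NormedAddCommGroup H] [InnerProductSpace 𝕜 H] [NormedAddCommGroup H'] [InnerProductSpace 𝕜 H']

theorem rank_starProjection_le {U : Submodule 𝕜 H} [FiniteDimensional 𝕜 U] {k : ℕ}
    (hU : Module.finrank 𝕜 U ≤ k) :
    LinearMap.rank (U.starProjection : H →ₗ[𝕜] H) ≤ (k : Cardinal) := by
  have hle : LinearMap.range (U.starProjection : H →ₗ[𝕜] H) ≤ U := by
    rintro _ ⟨x, rfl⟩
    exact U.starProjection_apply_mem x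
  refine (Submodule.rank_mono hle).trans ?_
  rw [← Module.finrank_eq_rank]
  exact_mod_cast hU

theorem rankApprox_of_sum_norm_sq_le (A : H →L[𝕜] H') {σ : ℝ} (hσ : 0 ≤ σ)
    (hA : ∀ (k : ℕ) (e : Fin k → H), Orthonormal 𝕜 e → ∑ i, ‖A (e i)‖ ^ 2 ≤ σ ^ 2) (k : ℕ) :
    RankApprox k (σ / √(k + 1 : ℝ)) A := by
  obtain ⟨U, _, hU, h⟩ := exists_norm_sub_comp_starProjection_le A hσ hA k
  exact ⟨_, (LinearMap.rank_comp_le_right U.starProjection.toLinearMap A.toLinearMap).trans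
    (rank_starProjection_le hU), h⟩

theorem rankApprox_of_sum_norm_sq_adjoint_le [CompleteSpace H] [CompleteSpace H'] (A : H →L[𝕜] H')
    {σ : ℝ} (hσ : 0 ≤ σ)
    (hA : ∀ (k : ℕ) (e : Fin k → H'), Orthonormal 𝕜 e →
      ∑ i, ‖ContinuousLinearMap.adjoint A (e i)‖ ^ 2 ≤ σ ^ 2) (k : ℕ) :
    RankApprox k (σ / √(k + 1 : ℝ)) A := by
  obtain ⟨U, _, hU, h⟩ := exists_norm_sub_comp_starProjection_le _ hσ hA k
  refine ⟨U.starProjection ∘L A,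
    (LinearMap.rank_comp_le_left A.toLinearMap U.starProjection.toLinearMap).trans
    (rank_starProjection_le hU), ?_⟩
  have e : ContinuousLinearMap.adjoint (ContinuousLinearMap.adjoint A -
      ContinuousLinearMap.adjoint A ∘L U.starProjection) = A - U.starProjection ∘L A := by
    rw [map_sub, ContinuousLinearMap.adjoint_comp, ContinuousLinearMap.adjoint_adjoint,
      (isSelfAdjoint_starProjection U).adjoint_eq]
  rw [← e, LinearIsometryEquiv.norm_map]
  exact h

end HilbertSchmidt

/-! ### Diagonal operators composed with maps from or to `ℓ_2` -/

section Diagonal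

variable {𝕜 : Type*} [RCLike 𝕜]

theorem sum_norm_sq_apply_le {H : Type*} [NormedAddCommGroup H] [InnerProductSpace 𝕜 H]
    [CompleteSpace H] (f : H →L[𝕜] 𝕜) {k : ℕ} {e : Fin k → H} (he : Orthonormal 𝕜 e) :
    ∑ i, ‖f (e i)‖ ^ 2 ≤ ‖f‖ ^ 2 := by
  have := he.sum_inner_products_le ((InnerProductSpace.toDual 𝕜 H).symm f) (s := Finset.univ)
  rw [LinearIsometryEquiv.norm_map] at this
  simpa only [norm_inner_symm (e _), InnerProductSpace.toDual_symm_apply] using this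

/-- Evaluation at a coordinate, as a functional on `c_0`. -/
noncomputable def CZero.eval (𝕜 : Type*) [RCLike 𝕜] (i : ℕ) : CZero 𝕜 →L[𝕜] 𝕜 :=
  LinearMap.mkContinuous { toFun x := x i, map_add' _ _ := rfl, map_smul' _ _ := rfl } 1
    fun x => by simpa using x.norm_apply_le i

theorem CZero.norm_eval_le (i : ℕ) : ‖CZero.eval 𝕜 i‖ ≤ 1 :=
  LinearMap.mkContinuous_norm_le _ zero_le_one _

/-- Coordinate `j` of `D_a u` is `a j` times a functional of norm at most `‖u‖`; Bessel bounds each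
coordinate, and the squares `‖a j‖²` are summable. -/
theorem sum_norm_sq_diagCZero_le (a : Ell2 𝕜) (u : Ell2 𝕜 →L[𝕜] CZero 𝕜) {k : ℕ}
    {e : Fin k → Ell2 𝕜} (he : Orthonormal 𝕜 e) :
    ∑ i, ‖(diagCZero a ∘L u) (e i)‖ ^ 2 ≤ (‖a‖ * ‖u‖) ^ 2 := by
  simp only [Ell2.norm_sq_eq_tsum]
  rw [← Summable.tsum_finsetSum fun i _ => Ell2.summable_norm_sq _, mul_pow,
    Ell2.norm_sq_eq_tsum a, ← tsum_mul_right]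
  refine Summable.tsum_le_tsum (fun j => ?_) (summable_sum fun i _ => Ell2.summable_norm_sq _)
    (a.summable_norm_sq.mul_right _)
  calc _ = ‖a j‖ ^ 2 * ∑ i, ‖(CZero.eval 𝕜 j ∘L u) (e i)‖ ^ 2 := by
        rw [Finset.mul_sum]
        refine Finset.sum_congr rfl fun i _ => ?_
        rw [ContinuousLinearMap.comp_apply, diagCZero_apply, norm_mul, mul_pow]
        rfl
    _ ≤ _ := by
        gcongr
        refine (sum_norm_sq_apply_le _ he).trans ?_
        gcongr
        exact (ContinuousLinearMap.opNorm_comp_le _ _).trans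
          (mul_le_of_le_one_left (norm_nonneg _) (CZero.norm_eval_le j))

/-- Coordinate `j` of the adjoint at `e i` is, up to conjugation, the inner product of `e i` with `v
D_b` at the `j`-th unit vector, whose norm is at most `‖b j‖ ‖v‖`; Bessel again. -/
theorem sum_norm_sq_adjoint_diagEll1_le (b : Ell2 𝕜) (v : Ell1 𝕜 →L[𝕜] Ell2 𝕜) {k : ℕ}
    {e : Fin k → Ell2 𝕜} (he : Orthonormal 𝕜 e) :
    ∑ i, ‖ContinuousLinearMap.adjoint (v ∘L diagEll1 b) (e i)‖ ^ 2 ≤ (‖b‖ * ‖v‖) ^ 2 := by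
  simp only [Ell2.norm_sq_eq_tsum]
  rw [← Summable.tsum_finsetSum fun i _ => Ell2.summable_norm_sq _, mul_pow,
    Ell2.norm_sq_eq_tsum b, ← tsum_mul_right]
  refine Summable.tsum_le_tsum (fun j => ?_) (summable_sum fun i _ => Ell2.summable_norm_sq _)
    (b.summable_norm_sq.mul_right _)
  have hd : diagEll1 b (lp.single 2 j 1) = b j • lp.single 1 j (1 : 𝕜) := by
    ext i
    rw [diagEll1_apply, lp.coeFn_smul, Pi.smul_apply, lp.single_apply, lp.single_apply,
      smul_eq_mul]
    by_cases h : i = j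
    · subst h; rfl
    · simp [h]
  calc _ = ∑ i, ‖inner 𝕜 (e i) ((v ∘L diagEll1 b) (lp.single 2 j 1))‖ ^ 2 := by
        refine Finset.sum_congr rfl fun i _ => ?_
        rw [← ContinuousLinearMap.adjoint_inner_left, norm_inner_symm, lp.inner_single_left]
        simp
    _ ≤ ‖(v ∘L diagEll1 b) (lp.single 2 j 1)‖ ^ 2 := he.sum_inner_products_le _
    _ ≤ (‖b j‖ * ‖v‖) ^ 2 := by
        gcongr
        rw [ContinuousLinearMap.comp_apply, hd, map_smul, norm_smul]
        gcongr
        refine (v.le_opNorm _).trans ?_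
        rw [lp.norm_single (by norm_num), norm_one, mul_one]
    _ = _ := mul_pow _ _ _

/-- The truncation of a sequence of `ℓ_2` to its first `n` coordinates. -/
noncomputable def Ell2.head (a : Ell2 𝕜) (n : ℕ) : Ell2 𝕜 :=
  ∑ i ∈ Finset.range n, lp.single 2 i (a i)

theorem Ell2.head_apply (a : Ell2 𝕜) (n i : ℕ) :
    a.head n i = ∑ j ∈ Finset.range n, lp.single 2 j (a j) i := by
  rw [Ell2.head, lp.coeFn_sum, Finset.sum_apply]

theorem Ell2.tendsto_norm_sub_head (a : Ell2 𝕜) :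
    Tendsto (fun n => ‖a - a.head n‖) atTop (𝓝 0) := by
  have := (lp.hasSum_single (by norm_num) a).tendsto_sum_nat.const_sub a
  simpa [Ell2.head] using this.norm

theorem rank_diagCZero_head_le (a : Ell2 𝕜) (n : ℕ) :
    LinearMap.rank (diagCZero (a.head n) : CZero 𝕜 →ₗ[𝕜] Ell2 𝕜) ≤ (n : Cardinal) := by
  refine rank_le_of_forall_eq_sum (v := fun i => lp.single 2 i (a i)) (c := fun x i => x i)
    fun x => ?_
  ext i
  rw [ContinuousLinearMap.coe_coe, diagCZero_apply, Ell2.head_apply, lp.coeFn_sum,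
    Finset.sum_apply, Finset.sum_mul]
  refine Finset.sum_congr rfl fun j _ => ?_
  rw [lp.coeFn_smul, Pi.smul_apply, smul_eq_mul, mul_comm, lp.single_apply]
  by_cases h : i = j
  · subst h; rfl
  · simp [h]

theorem rank_diagEll1_head_le (b : Ell2 𝕜) (n : ℕ) :
    LinearMap.rank (diagEll1 (b.head n) : Ell2 𝕜 →ₗ[𝕜] Ell1 𝕜) ≤ (n : Cardinal) := by
  refine rank_le_of_forall_eq_sum (v := fun i => lp.single 1 i (b i)) (c := fun x i => x i)
    fun x => ?_
  ext i
  rw [ContinuousLinearMap.coe_coe, diagEll1_apply, Ell2.head_apply, lp.coeFn_sum,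
    Finset.sum_apply, Finset.sum_mul]
  refine Finset.sum_congr rfl fun j _ => ?_
  rw [lp.coeFn_smul, Pi.smul_apply, smul_eq_mul, mul_comm, lp.single_apply, lp.single_apply]
  by_cases h : i = j
  · subst h; rfl
  · simp [h]

/-- The head of `a` is absorbed exactly at rank `n`; only the tail enters the error. -/
theorem rankApprox_diagCZero_comp (a : Ell2 𝕜) (u : Ell2 𝕜 →L[𝕜] CZero 𝕜) (n k : ℕ) :
    RankApprox (n + k) (‖a - a.head n‖ * ‖u‖ / √(k + 1 : ℝ)) (diagCZero a ∘L u) := by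
  have h := (rankApprox_of_sum_norm_sq_le (diagCZero (a - a.head n) ∘L u) (by positivity)
    (fun k e he => sum_norm_sq_diagCZero_le _ u he) k).add_rank (m := n)
    (F := diagCZero (a.head n) ∘L u)
    ((LinearMap.rank_comp_le_left u.toLinearMap (diagCZero (a.head n)).toLinearMap).trans
      (rank_diagCZero_head_le a n))
  rwa [← ContinuousLinearMap.add_comp, ← diagCZero_add, add_sub_cancel] at h

theorem rankApprox_comp_diagEll1 (b : Ell2 𝕜) (v : Ell1 𝕜 →L[𝕜] Ell2 𝕜) (n k : ℕ) :
    RankApprox (n + k) (‖b - b.head n‖ * ‖v‖ / √(k + 1 : ℝ)) (v ∘L diagEll1 b) := by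
  have h := (rankApprox_of_sum_norm_sq_adjoint_le (v ∘L diagEll1 (b - b.head n)) (by positivity)
    (fun k e he => sum_norm_sq_adjoint_diagEll1_le _ v he) k).add_rank (m := n)
    (F := v ∘L diagEll1 (b.head n))
    ((LinearMap.rank_comp_le_right (diagEll1 (b.head n)).toLinearMap v.toLinearMap).trans
      (rank_diagEll1_head_le b n))
  rwa [← ContinuousLinearMap.comp_add, ← diagEll1_add, add_sub_cancel] at h

end Diagonal

/-! ### Limits and optimality -/

section Limits

variable {𝕜 : Type*} [RCLike 𝕜]

theorem approxNumber_nonneg {X Y : Type*} [NormedAddCommGroup X] [NormedSpace 𝕜 X]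
    [NormedAddCommGroup Y] [NormedSpace 𝕜 Y] (n : ℕ) (T : X →L[𝕜] Y) : 0 ≤ approxNumber n T :=
  Real.sInf_nonneg (by rintro _ ⟨S, -, rfl⟩; exact norm_nonneg _)

theorem tendsto_zero_of_eventually_le {f τ : ℕ → ℝ} (hf : ∀ m, 0 ≤ f m)
    (hτ : Tendsto τ atTop (𝓝 0)) (h : ∀ n, ∀ᶠ m in atTop, f m ≤ τ n) :
    Tendsto f atTop (𝓝 0) := by
  refine tendsto_order.2 ⟨fun a ha => Eventually.of_forall fun m => ha.trans_le (hf m),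
    fun a ha => ?_⟩
  obtain ⟨n, hn⟩ := ((tendsto_order.1 hτ).2 a ha).exists
  exact (h n).mono fun m hm => hm.trans_lt hn

theorem tendsto_const_mul_mul_const {f : ℕ → ℝ} (hf : Tendsto f atTop (𝓝 0)) (c d : ℝ) :
    Tendsto (fun n => c * (f n * d)) atTop (𝓝 0) := by
  simpa only [zero_mul, mul_zero] using (hf.mul_const d).const_mul c

theorem tendsto_const_mul_mul_mul {f g : ℕ → ℝ} (hf : Tendsto f atTop (𝓝 0))
    (hg : Tendsto g atTop (𝓝 0)) (c d : ℝ) :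
    Tendsto (fun n => c * (f n * d * g n)) atTop (𝓝 0) := by
  simpa only [zero_mul, mul_zero] using ((hf.mul_const d).mul hg).const_mul c

theorem sqrt_mul_le_two_mul {n m : ℕ} (hm : 2 * n + 1 ≤ m) {s c : ℝ} (hc : 0 ≤ c)
    (hs : s ≤ c / √((m - 1 - n : ℕ) + 1 : ℝ)) : √(m : ℝ) * s ≤ 2 * c := by
  have hpos : 0 < √((m - 1 - n : ℕ) + 1 : ℝ) := Real.sqrt_pos.2 (by positivity)
  have h1 : √(m : ℝ) ≤ 2 * √((m - 1 - n : ℕ) + 1 : ℝ) := by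
    rw [Real.sqrt_le_left (by positivity), mul_pow, Real.sq_sqrt (by positivity)]
    have : m ≤ 2 ^ 2 * (m - 1 - n + 1) := by omega
    exact_mod_cast this
  calc √(m : ℝ) * s ≤ √(m : ℝ) * (c / √((m - 1 - n : ℕ) + 1 : ℝ)) := by gcongr
    _ ≤ 2 * √((m - 1 - n : ℕ) + 1 : ℝ) * (c / √((m - 1 - n : ℕ) + 1 : ℝ)) := by gcongr
    _ = 2 * c := by field_simp

theorem tendsto_sqrt_mul_weylNumber (T : CZero 𝕜 →L[𝕜] Ell1 𝕜) :
    Tendsto (fun k : ℕ => √(k : ℝ) * weylNumber k T) atTop (𝓝 0) := by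
  obtain ⟨a, b, B, rfl⟩ := exists_factorization T
  refine tendsto_zero_of_eventually_le (τ := fun n => 2 * (‖diagEll1 b ∘L B‖ * ‖a - a.head n‖))
    (fun m => mul_nonneg (Real.sqrt_nonneg _) (Real.sSup_nonneg ?_)) ?_ fun n => ?_
  · rintro _ ⟨u, -, rfl⟩
    exact approxNumber_nonneg _ _
  · simpa only [zero_mul, mul_zero] using (a.tendsto_norm_sub_head.const_mul ‖diagEll1 b ∘L B‖).const_mul 2
  · filter_upwards [eventually_ge_atTop (2 * n + 1)] with m hm
    refine sqrt_mul_le_two_mul hm (by positivity) ((weylNumber_isLUB _ _).2 ?_)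
    rintro _ ⟨u, hu, rfl⟩
    -- The total rank is `n + (m - 1 - n) = m - 1`, the largest allowed by `rank < m`.
    have h := (rankApprox_diagCZero_comp a u n (m - 1 - n)).comp_left (diagEll1 b ∘L B)
    rw [ContinuousLinearMap.comp_assoc] at h ⊢
    rw [ContinuousLinearMap.comp_assoc]
    refine (h.approxNumber_le (m := m) (by omega)).trans ?_
    rw [← mul_div_assoc]
    gcongr
    exact mul_le_of_le_one_right (norm_nonneg _) hu

theorem tendsto_sqrt_mul_changNumber (T : CZero 𝕜 →L[𝕜] Ell1 𝕜) :
    Tendsto (fun k : ℕ => √(k : ℝ) * changNumber k T) atTop (𝓝 0) := by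
  obtain ⟨a, b, B, rfl⟩ := exists_factorization T
  refine tendsto_zero_of_eventually_le (τ := fun n => 2 * (‖b - b.head n‖ * ‖B ∘L diagCZero a‖))
    (fun m => mul_nonneg (Real.sqrt_nonneg _) (Real.sSup_nonneg ?_)) ?_ fun n => ?_
  · rintro _ ⟨v, -, rfl⟩
    exact approxNumber_nonneg _ _
  · exact tendsto_const_mul_mul_const b.tendsto_norm_sub_head 2 _
  · filter_upwards [eventually_ge_atTop (2 * n + 1)] with m hm
    refine sqrt_mul_le_two_mul hm (by positivity) ((changNumber_isLUB _ _).2 ?_)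
    rintro _ ⟨v, hv, rfl⟩
    have h := (rankApprox_comp_diagEll1 b v n (m - 1 - n)).comp_right (B ∘L diagCZero a)
    rw [ContinuousLinearMap.comp_assoc] at h
    refine (h.approxNumber_le (m := m) (by omega)).trans ?_
    rw [div_mul_eq_mul_div]
    gcongr
    exact mul_le_of_le_one_right (norm_nonneg _) hv

theorem tendsto_mul_hilbertNumber (T : CZero 𝕜 →L[𝕜] Ell1 𝕜) :
    Tendsto (fun k : ℕ => (k : ℝ) * hilbertNumber k T) atTop (𝓝 0) := by
  obtain ⟨a, b, B, rfl⟩ := exists_factorization T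
  refine tendsto_zero_of_eventually_le
    (τ := fun n => 4 * (‖b - b.head n‖ * ‖B‖ * ‖a - a.head n‖))
    (fun m => mul_nonneg (Nat.cast_nonneg _) (Real.sSup_nonneg ?_)) ?_ fun n => ?_
  · rintro _ ⟨u, v, -, rfl⟩
    exact approxNumber_nonneg _ _
  · exact tendsto_const_mul_mul_mul b.tendsto_norm_sub_head a.tendsto_norm_sub_head 4 _
  · filter_upwards [eventually_ge_atTop (8 * n + 8)] with m hm
    have hbound : hilbertNumber m (diagEll1 b ∘L B ∘L diagCZero a)
        ≤ ‖b - b.head n‖ * ‖B‖ * ‖a - a.head n‖ / ((m / 4 : ℕ) + 1 : ℝ) := by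
      refine (hilbertNumber_isLUB _ _).2 ?_
      rintro _ ⟨u, v, huv, rfl⟩
      -- Each end uses rank `n + m / 4`; together they stay below `m` since `m ≥ 8n + 8`, and the
      -- two square roots multiply to `m / 4 + 1`.
      have h := ((rankApprox_diagCZero_comp a u n (m / 4)).comp_left B).comp
        (rankApprox_comp_diagEll1 b v n (m / 4))
      rw [ContinuousLinearMap.comp_assoc] at h ⊢
      rw [ContinuousLinearMap.comp_assoc]
      refine (h.approxNumber_le (m := m) (by omega)).trans ?_
      have hsq : √((m / 4 : ℕ) + 1 : ℝ) * √((m / 4 : ℕ) + 1 : ℝ) = (m / 4 : ℕ) + 1 :=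
        Real.mul_self_sqrt (by positivity)
      calc _ = ‖b - b.head n‖ * ‖B‖ * ‖a - a.head n‖ * (‖u‖ * ‖v‖) /
            (√((m / 4 : ℕ) + 1 : ℝ) * √((m / 4 : ℕ) + 1 : ℝ)) := by ring
        _ ≤ _ := by
          rw [hsq]
          exact div_le_div_of_nonneg_right (mul_le_of_le_one_right (by positivity) huv)
            (by positivity)
    have hm4 : (m : ℝ) ≤ 4 * ((m / 4 : ℕ) + 1 : ℝ) := by
      have : m ≤ 4 * (m / 4 + 1) := by omega
      exact_mod_cast this
    calc _ ≤ (m : ℝ) * (‖b - b.head n‖ * ‖B‖ * ‖a - a.head n‖ / ((m / 4 : ℕ) + 1 : ℝ)) := by gcongr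
      _ ≤ 4 * ((m / 4 : ℕ) + 1 : ℝ) *
          (‖b - b.head n‖ * ‖B‖ * ‖a - a.head n‖ / ((m / 4 : ℕ) + 1 : ℝ)) := by gcongr
      _ = _ := by field_simp

/-- If the numbers `s` are `o(1 / g)` on every operator, then an admissible lower rate is
`O(1 / g)`. -/
theorem AdmissibleLowerRate.exists_le_div {X Y : Type*} [NormedAddCommGroup X] [NormedSpace 𝕜 X]
    [NormedAddCommGroup Y] [NormedSpace 𝕜 Y] {s : ℕ → (X →L[𝕜] Y) → ℝ} {φ g : ℕ → ℝ}
    (h : AdmissibleLowerRate s φ) (hg : ∀ m, 1 ≤ m → 0 < g m)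
    (hs : ∀ T, Tendsto (fun m => g m * s m T) atTop (𝓝 0)) :
    ∃ C : ℝ, ∀ m : ℕ, 1 ≤ m → φ m ≤ C / g m := by
  by_contra! hcon
  -- The running maximum makes `1/G` antitone, and the floor `1` makes it positive.
  set G : ℕ →o ℝ := partialSups fun m => max 1 (g m * φ m) with hG
  have hGle : ∀ m, max 1 (g m * φ m) ≤ G m := fun m =>
    le_partialSups (fun m => max 1 (g m * φ m)) m
  have hG1 : ∀ m, 1 ≤ G m := fun m => (le_max_left _ _).trans (hGle m)
  have hG0 : ∀ m, 0 < G m := fun m => zero_lt_one.trans_le (hG1 m)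
  have hGtop : Tendsto G atTop atTop := by
    refine tendsto_atTop_atTop_of_monotone G.monotone fun C => ?_
    obtain ⟨m, hm, hC⟩ := hcon C
    rw [div_lt_iff₀ (hg m hm), mul_comm] at hC
    exact ⟨m, hC.le.trans ((le_max_right _ _).trans (hGle m))⟩
  obtain ⟨T, hT⟩ := h (fun m => (G m)⁻¹) (fun i j hij => inv_anti₀ (hG0 i) (G.monotone hij))
    hGtop.inv_tendsto_atTop
  obtain ⟨N, hN⟩ := eventually_atTop.1 ((tendsto_order.1 (hs T)).2 1 one_pos)
  have hlt : ∀ m, N ≤ m → 1 ≤ m → g m * φ m < G m := by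
    intro m hm hm1
    have h1 := mul_le_mul_of_nonneg_left (hT m hm1) (hg m hm1).le
    have h2 := h1.trans_lt (hN m hm)
    rwa [mul_left_comm, inv_mul_lt_iff₀ (hG0 m), mul_one] at h2
  -- A strict increase of `G` at `m + 1` would force `G (m + 1) = g (m + 1) φ (m + 1)`, against
  -- `hlt`; so `G` stops growing at `N`, contradicting `hGtop`.
  have hbd : ∀ m, N ≤ m → G m ≤ G N := by
    intro m hm
    induction m, hm using Nat.le_induction with
    | base => exact le_rfl
    | succ m hm ih =>
      have hsucc : G (m + 1) = max (G m) (max 1 (g (m + 1) * φ (m + 1))) := by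
        rw [hG, partialSups_add_one]
      have hl := hlt (m + 1) (by omega) (by omega)
      have : G (m + 1) ≤ G m := by
        by_contra! hc
        have hm1 := hG1 m
        rw [hsucc] at hl hc
        rcases lt_max_iff.1 hc with h | h
        · exact lt_irrefl _ h
        · rcases lt_max_iff.1 h with h | h
          · linarith
          · rw [max_eq_right (hm1.trans h.le), max_eq_right h.le] at hl
            exact lt_irrefl _ hl
      exact this.trans ih
  obtain ⟨m, hm⟩ := ((tendsto_atTop.1 hGtop (G N + 1)).and (eventually_ge_atTop N)).exists
  have := hbd m hm.2
  linarith [hm.1]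

end Limits

end SNumbers


theorem mainTheorem2 (𝕜 : Type*) [RCLike 𝕜] :
    (∀ T : SNumbers.CZero 𝕜 →L[𝕜] SNumbers.Ell1 𝕜,
      Tendsto (fun k : ℕ => Real.sqrt (k : ℝ) * SNumbers.weylNumber k T) atTop (𝓝 0) ∧
      Tendsto (fun k : ℕ => Real.sqrt (k : ℝ) * SNumbers.changNumber k T) atTop (𝓝 0) ∧
      Tendsto (fun k : ℕ => (k : ℝ) * SNumbers.hilbertNumber k T) atTop (𝓝 0)) ∧
    (∀ φ : ℕ → ℝ,
      (SNumbers.AdmissibleLowerRate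
          (fun m (T : SNumbers.CZero 𝕜 →L[𝕜] SNumbers.Ell1 𝕜) => SNumbers.weylNumber m T) φ →
        ∃ C : ℝ, ∀ m : ℕ, 1 ≤ m → φ m ≤ C / Real.sqrt (m : ℝ)) ∧
      (SNumbers.AdmissibleLowerRate
          (fun m (T : SNumbers.CZero 𝕜 →L[𝕜] SNumbers.Ell1 𝕜) => SNumbers.changNumber m T) φ →
        ∃ C : ℝ, ∀ m : ℕ, 1 ≤ m → φ m ≤ C / Real.sqrt (m : ℝ)) ∧
      (SNumbers.AdmissibleLowerRate
          (fun m (T : SNumbers.CZero 𝕜 →L[𝕜] SNumbers.Ell1 𝕜) => SNumbers.hilbertNumber m T) φ →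
        ∃ C : ℝ, ∀ m : ℕ, 1 ≤ m → φ m ≤ C / (m : ℝ))) := by
  have hpos : ∀ m : ℕ, 1 ≤ m → (0 : ℝ) < m := fun m hm => by exact_mod_cast hm
  exact ⟨fun T => ⟨SNumbers.tendsto_sqrt_mul_weylNumber T, SNumbers.tendsto_sqrt_mul_changNumber T,
      SNumbers.tendsto_mul_hilbertNumber T⟩,
    fun φ => ⟨
      fun h => h.exists_le_div (fun m hm => Real.sqrt_pos.2 (hpos m hm))
        SNumbers.tendsto_sqrt_mul_weylNumber,
      fun h => h.exists_le_div (fun m hm => Real.sqrt_pos.2 (hpos m hm))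
        SNumbers.tendsto_sqrt_mul_changNumber,
      fun h => h.exists_le_div hpos SNumbers.tendsto_mul_hilbertNumber⟩⟩
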